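/- Let $m,n\ge 0$ be integers with $2n\le m$, and let $\mathfrak g=\mathfrak{sp}_{2m}(\mathbb C)$ be the Lie algebra of the matrices $\begin{pmatrix}T&B\\C&-T^{t}\end{pmatrix}$ with $m\times m$ blocks and $B,C$ symmetric, on which $G=\mathrm{Sp}_{2m}(\mathbb C)$ acts by conjugation. Let $J_k$ be the $k\times k$ nilpotent Jordan block (ones just above the diagonal), let $\mathcal E_{k,k}$ be the $k\times k$ matrix with $1$ in position $(k,k)$ and zeros elsewhere, let $l_k=\operatorname{diag}(2k-1,2k-3,\dots,1)$, and put $$X_n=\begin{pmatrix}J_{m-n}&0&\mathcal E_{m-n,m-n}&0\\0&J_n&0&\mathcal E_{n,n}\\0&0&-J_{m-n}^{t}&0\\0&0&0&-J_n^{t}\end{pmatrix},\qquad H_n=\operatorname{diag}(l_{m-n},\,l_n,\,-l_{m-n},\,-l_n).$$ For complex numbers $a_i,y_i,z_i$ $(1\le i\le n)$ and $d_j$ $(1\le j\le m-n)$ define $S=S(a,y,z,d)\in\mathfrak g$ as follows. If $2n<m$, then $S=X_n+\begin{pmatrix}0&0\\M&0\end{pmatrix}$, where $M$ is the symmetric $m\times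 m$ matrix with diagonal $(d_{m-n},\dots,d_1,a_n,\dots,a_1)$, with $M_{1,m-n+j}=y_j$ and $M_{j+1,m}=z_j$ for $1\le j\le n$, the transposed entries, and zeros elsewhere. If $2n=m$, then $S=X_n+\begin{pmatrix}0&0\\M'&0\end{pmatrix}+z_n\,(E_{m,n}-E_{m+n,2m})$, where $M'$ is the symmetric matrix with diagonal $(d_n,\dots,d_2,\,d_1-z_n^2,\,a_n,\dots,a_1)$, with $M'_{1,n+j}=y_j$ for $1\le j\le n$ and $M'_{j+1,m}=z_j$ for $1\le j\le n-1$, the transposed entries, and zeros elsewhere (for $n=0$ nothing is changed and no $z_n$ occurs). Let $\mathcal S_n=\{S(a,y,z,d)\}$ be the set of all these matrices. Then: 1. $X_n\in\mathfrak g$ is nilpotent with Jordan blocks of sizes $2(m-n)$ and $2n$ (a block of size $0$ being absent). 2. $\mathcal S_n$ is an affine subspace $X_n+V_n$ of $\mathfrak g$, and it is a transverse slice at $X_n$ to the adjoint orbit $\mathcal O_{X_n}=\{gX_ng^{-1}\mid g\in G\}$: $\ \mathfrak g=V_n\oplus T_{X_n}(\mathcal O_{X_n})$. 3. $H_n$ is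 the neutral element of a Jacobson–Morozov triple $(H_n,X_n,N)$ in $\mathfrak g$ (that is, $[H_n,X_n]=2X_n$, $[H_n,N]=-2N$, $[X_n,N]=H_n$), and $\mathcal S_n$ is invariant under the $\mathbb C^*$-action $$\lambda_r(Y)=r\exp\!\left(-\log(r)\,H_n/2\right)\,Y\,\exp\!\left(\log(r)\,H_n/2\right):\qquad \lambda_r(\mathcal S_n)=\mathcal S_n\ \text{ for all } r\in\mathbb C^*.$$ 4. For all $a,y,z,d$ the characteristic polynomial of $S=S(a,y,z,d)$ is $$\chi_S(t)=A(t)D(t)+(-1)^{m+1}B(t)B(-t),$$ where $$A(t)=t^{2n}-a_1t^{2(n-1)}+\cdots+(-1)^{n-1}a_{n-1}t^2+(-1)^na_n,$$ $$D(t)=t^{2(m-n)}-d_1t^{2(m-n-1)}+\cdots+(-1)^{m-n-1}d_{m-n-1}t^2+(-1)^{m-n}d_{m-n},$$ $$B(t)=y_1+y_2t+\cdots+y_nt^{n-1}-t^n\left(z_1-z_2t+\cdots+(-1)^{n-1}z_nt^{n-1}\right).$$ -/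

import Mathlib

noncomputable section

namespace SympSlice

open Matrix Polynomial

/-! ### Adjoint orbits of the symplectic group, transverse slices, the `ℂˣ`-action -/

section General

attribute [local instance] LieRing.ofAssociativeRing

variable {l : Type} [Fintype l] [DecidableEq l]

variable (l) in
/-- The symplectic Lie algebra over `ℂ`, as a space of matrices. -/
def spC : Submodule ℂ (Matrix (l ⊕ l) (l ⊕ l) ℂ) := (LieAlgebra.Symplectic.sp l ℂ).toSubmodule

/-- The tangent space at `X` of the adjoint orbit `{g X g⁻¹ | g ∈ Sp}` of the complex symplectic
group: the space of velocities at `t = 0` of the curves `t ↦ g(t) X g(t)⁻¹`, where `g` runs over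
the holomorphic curves in `Sp` with `g(0) = 1` (that is, the image of the differential at the
identity of the orbit map `g ↦ g X g⁻¹`). -/
def orbitTangent (X : Matrix (l ⊕ l) (l ⊕ l) ℂ) :
    Submodule ℂ (Matrix (l ⊕ l) (l ⊕ l) ℂ) :=
  Submodule.span ℂ {v | ∃ g : ℂ → Matrix (l ⊕ l) (l ⊕ l) ℂ,
    (∀ t, g t ∈ symplecticGroup l ℂ) ∧ g 0 = 1 ∧
    (∀ i j, Differentiable ℂ (fun t => g t i j)) ∧
    ∀ i j, HasDerivAt (fun t => (g t * X * (g t)⁻¹) i j) (v i j) 0}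

/-- `S` is an affine subspace of `sp` that is a transverse slice at `X ∈ S` to the adjoint orbit
of `X`: the tangent space of `S` at `X`, which is the direction of the affine subspace, is
complementary in `sp` to the tangent space of the orbit. -/
def IsAffineTransverseSlice (S : Set (Matrix (l ⊕ l) (l ⊕ l) ℂ))
    (X : Matrix (l ⊕ l) (l ⊕ l) ℂ) : Prop :=
  ∃ A : AffineSubspace ℂ (Matrix (l ⊕ l) (l ⊕ l) ℂ),
    (A : Set (Matrix (l ⊕ l) (l ⊕ l) ℂ)) = S ∧
    (∀ Y ∈ S, Y ∈ spC l) ∧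
    X ∈ S ∧
    A.direction ⊓ orbitTangent X = ⊥ ∧
    A.direction ⊔ orbitTangent X = spC l

/-- `(H, X, N)` is a Jacobson-Morozov triple in `sp` with nilpositive element `X`. -/
structure IsJMTriple (H X N : Matrix (l ⊕ l) (l ⊕ l) ℂ) : Prop where
  memH : H ∈ spC l
  memX : X ∈ spC l
  memN : N ∈ spC l
  lie_H_X : H * X - X * H = (2 : ℂ) • X
  lie_H_N : H * N - N * H = (-2 : ℂ) • N
  lie_X_N : X * N - N * X = H

/-- `λ_r(Y) = r exp(-log(r) H / 2) Y exp(log(r) H / 2)`. -/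
def lambdaAction (H : Matrix (l ⊕ l) (l ⊕ l) ℂ) (r : ℂ) (Y : Matrix (l ⊕ l) (l ⊕ l) ℂ) :
    Matrix (l ⊕ l) (l ⊕ l) ℂ :=
  r • (NormedSpace.exp (-(Complex.log r / 2) • H) * Y *
    NormedSpace.exp ((Complex.log r / 2) • H))

/-- Invariance under the action `λ` determined by `H`. -/
def IsLambdaInvariant (H : Matrix (l ⊕ l) (l ⊕ l) ℂ)
    (S : Set (Matrix (l ⊕ l) (l ⊕ l) ℂ)) : Prop :=
  ∀ r : ℂ, r ≠ 0 → lambdaAction H r '' S = S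

end General

/-! ### The slices -/

/-- The nilpotent Jordan block of size `k`, with ones just above the diagonal. -/
def jordan (k : ℕ) : Matrix (Fin k) (Fin k) ℂ :=
  Matrix.of fun i j => if i.val + 1 = j.val then 1 else 0

/-- `X` is nilpotent with Jordan blocks of sizes `p` and `q` (a block of size `0` is absent). -/
def HasPartition {ι : Type} [Fintype ι] [DecidableEq ι] (X : Matrix ι ι ℂ) (p q : ℕ) : Prop :=
  ∃ (P : Matrix ι (Fin p ⊕ Fin q) ℂ) (Q : Matrix (Fin p ⊕ Fin q) ι ℂ),
    P * Q = 1 ∧ Q * P = 1 ∧ X * P = P * fromBlocks (jordan p) 0 0 (jordan q)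

/-- The `k × k` matrix with `1` in position `(k, k)` and zeros elsewhere. -/
def corner (k : ℕ) : Matrix (Fin k) (Fin k) ℂ :=
  Matrix.of fun i j => if i.val + 1 = k ∧ j.val + 1 = k then 1 else 0

/-- The index set `{1, …, m}`, split as `{1, …, m - n}` followed by `{m - n + 1, …, m}`;
`sp_{2m}` consists of matrices indexed by `Idx m n ⊕ Idx m n`. -/
abbrev Idx (m n : ℕ) : Type := Fin (m - n) ⊕ Fin n

/-- Matrices of size `2m`. -/
abbrev Mat (m n : ℕ) : Type := Matrix (Idx m n ⊕ Idx m n) (Idx m n ⊕ Idx m n) ℂ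

/-- The nilpotent element `X_n`. -/
def nilX (m n : ℕ) : Mat m n :=
  fromBlocks
    (fromBlocks (jordan (m - n)) 0 0 (jordan n)) (fromBlocks (corner (m - n)) 0 0 (corner n))
    0 (fromBlocks (-(jordan (m - n))ᵀ) 0 0 (-(jordan n)ᵀ))

/-- The entries `2k - 1, 2k - 3, …, 1`. -/
def weights (k : ℕ) (i : Fin k) : ℂ := 2 * (k : ℂ) - 2 * (i.val : ℂ) - 1

/-- The neutral element `H_n = diag(l_{m-n}, l_n, -l_{m-n}, -l_n)`, with
`l_k = diag(2k - 1, 2k - 3, …, 1)`. -/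
def neutralH (m n : ℕ) : Mat m n :=
  Matrix.diagonal (Sum.elim (Sum.elim (weights (m - n)) (weights n))
    (Sum.elim (fun i => -weights (m - n) i) (fun i => -weights n i)))

variable {m n : ℕ}

/-- The upper right block of `M(a, y, z, d)`: its first row is `y_1, …, y_n`, and its last column
continues below `y_n` with `z_1, z_2, …`. If `m = 2n` it has only `n` rows, so that there is room
for `z_1, …, z_{n-1}` only. (The coordinates `y_j`, `z_j`, `a_j`, `d_j` with `j = 1, 2, …` are
`y (j-1)`, … below.) -/
def crossBlock (y z : Fin n → ℂ) : Matrix (Fin (m - n)) (Fin n) ℂ :=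
  Matrix.of fun i k => (if i.val = 0 then y k else 0) +
    ∑ j : Fin n, if i.val = j.val + 1 ∧ k.val + 1 = n then z j else 0

/-- The symmetric matrix `M(a, y, z, d)`, with diagonal
`d_{m-n}, …, d_1, a_n, …, a_1`. -/
def lowerM (a y z : Fin n → ℂ) (d : Fin (m - n) → ℂ) : Matrix (Idx m n) (Idx m n) ℂ :=
  fromBlocks (diagonal fun i => d i.rev) (crossBlock y z)
    (crossBlock (m := m) y z)ᵀ (diagonal fun i => a i.rev)

/-- The last coordinate `z_n` (zero if `n = 0`). -/
def zLast (z : Fin n → ℂ) : ℂ := ∑ j : Fin n, if j.val + 1 = n then z j else 0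

/-- For `m = 2n`: the `m × m` matrix with `z_n` in position `(m, n)` and zeros elsewhere. -/
def extraZ (z : Fin n → ℂ) : Matrix (Idx m n) (Idx m n) ℂ :=
  fromBlocks 0 0
    (Matrix.of fun i j => if i.val + 1 = n ∧ j.val + 1 = m - n then zLast z else 0) 0

/-- The element `S(a, y, z, d)` of the slice. If `m ≠ 2n` it is `X_n` plus the matrix with lower
left block `M(a, y, z, d)`. If `m = 2n`, the entry `d_1` of `M` is replaced by `d_1 - z_n²`, and
`z_n` times the root vector `E_{m,n} - E_{m+n,2m}` is added. -/
def sliceS (a y z : Fin n → ℂ) (d : Fin (m - n) → ℂ) : Mat m n :=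
  if m = 2 * n then
    nilX m n + fromBlocks (extraZ z) 0
      (lowerM a y z d - fromBlocks ((zLast z) ^ 2 • corner (m - n)) 0 0 0) (-(extraZ z)ᵀ)
  else
    nilX m n + fromBlocks 0 0 (lowerM a y z d) 0

variable (m n) in
/-- The slice `𝒮_n`. -/
def slice : Set (Mat m n) := {S | ∃ a y z d, S = sliceS a y z d}

/-- For `c = (c_1, …, c_k)`, the polynomial
`t^{2k} - c_1 t^{2(k-1)} + c_2 t^{2(k-2)} - ⋯ + (-1)^k c_k`. -/
def evenPoly {k : ℕ} (c : Fin k → ℂ) : ℂ[X] :=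
  X ^ (2 * k) + ∑ j : Fin k, C ((-1) ^ (j.val + 1) * c j) * X ^ (2 * (k - (j.val + 1)))

/-- `B(t) = y_1 + y_2 t + ⋯ + y_n t^{n-1} - t^n (z_1 - z_2 t + ⋯ + (-1)^{n-1} z_n t^{n-1})`. -/
def polyB (y z : Fin n → ℂ) : ℂ[X] :=
  ∑ j : Fin n, C (y j) * X ^ j.val - X ^ n * ∑ j : Fin n, C ((-1) ^ j.val * z j) * X ^ j.val

end SympSlice

end

/-!
Write `p = m - n` and `q = n`, and let `e_i`, `f_i` be the basis vectors of the two halves of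
`ℂ^{2m}`.

**Jordan chains.** In each of the two blocks `X_n` maps, up to signs, `f_1 ↦ f_2 ↦ ⋯ ↦ f_k ↦ e_k ↦ ⋯
↦ e_1`, so up to signs the standard basis, reordered by `chainEquiv`, consists of two Jordan chains
of lengths `2p` and `2q` (`chainForm_nilX`). Reversal of a chain corresponds to the symplectic form.

**Transversality.** The tangent space of the orbit is `[sp, X_n]` (`orbitTangent_eq`). In chain
coordinates the matrices commuting with `X_n` are, block by block, intertwiners of nilpotent Jordan
blocks: they are constant along diagonals, and only certain diagonals can be nonzero. The slice is
`X_n` plus the space `sliceDirection` of elements of `sp` supported on a set of positions that meets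
each of these diagonals exactly once, apart from the even diagonals of the diagonal blocks, on which
elements of `sp` commuting with `X_n` vanish. Hence an element of `sp` that commutes with `X_n` and
is orthogonal to `sliceDirection` for the trace form is zero
(`eq_zero_of_commute_of_trace_orthogonal`); as the trace form is nondegenerate on `sp` and the
orthogonal complement of `[sp, X_n]` in `sp` is the centralizer of `X_n`, `sliceDirection` and `[sp,
X_n]` span `sp`. Conversely the sum of the entries of `[A, X_n]` along each of these diagonals is
the trace of a product with an intertwiner and vanishes, so the two spaces meet in zero
(`disjoint_sliceDirection`).

**The action.** As `H_n` is diagonal, `λ_r` multiplies each matrix entry by a nonzero number. It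
fixes `X_n`, whose entries have weight `2`, and it preserves `sp` and supports, hence the slice.

**The characteristic polynomial.** Let `ζ = z_n` if `m = 2n` and `ζ = 0` otherwise. The upper right
block of `S` is `ε εᵀ` with `ε = (e_p, e_{p+q})`. For `t ≠ 0`, Schur's formula and `det (1 + U V) =
det (1 + V U)` turn `det (t - S)` into `t^{2m}` times the determinant of `1 + R(-t)ᵀ M R(t)`, a `2 ×
2` matrix, where `M` is the lower left block of `S` and the columns of `R(t)` are those of the
resolvent of the upper left block at `ε`; they are made of powers of `t⁻¹`
(`det_fromBlocks_of_low_rank`). The diagonal entries give `A(t)` and `D(t)`, the other two give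
`B(t)` and `B(-t)`; for `m = 2n` the terms in `ζ` supply the `z_n`-term of `B`, and the correction
`-ζ²` of `d_1` cancels the quadratic ones (`det_one_add_resolventCols`, `crossPairing_add`).
-/

noncomputable section

namespace SympSlice

open Matrix Polynomial

/-! ### The symplectic Lie algebra and the trace form -/

section Symplectic

attribute [local instance] LieRing.ofAssociativeRing

variable {l : Type} [Fintype l] [DecidableEq l]

theorem mem_spC_iff {A : Matrix (l ⊕ l) (l ⊕ l) ℂ} :
    A ∈ spC l ↔ Aᵀ * Matrix.J l ℂ = -(Matrix.J l ℂ * A) := by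
  rw [spC, LieSubalgebra.mem_toSubmodule, LieAlgebra.Symplectic.sp,
    mem_skewAdjointMatricesLieSubalgebra, mem_skewAdjointMatricesSubmodule, Matrix.IsSkewAdjoint,
    Matrix.IsAdjointPair, Matrix.mul_neg]

theorem fromBlocks_mem_spC_iff {P Q R S : Matrix l l ℂ} :
    fromBlocks P Q R S ∈ spC l ↔ S = -Pᵀ ∧ Qᵀ = Q ∧ Rᵀ = R := by
  rw [mem_spC_iff, Matrix.J, fromBlocks_transpose, fromBlocks_multiply, fromBlocks_multiply,
    fromBlocks_neg, fromBlocks_inj]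
  simp only [Matrix.mul_zero, Matrix.mul_one, zero_add, Matrix.mul_neg, add_zero, Matrix.zero_mul,
    Matrix.neg_mul, Matrix.one_mul, neg_neg]
  constructor
  · rintro ⟨h1, h2, h3, h4⟩
    exact ⟨h2.symm, by simpa using h4, h1⟩
  · rintro ⟨h1, h2, h3⟩
    subst h1
    exact ⟨h3, by simp, by simp, by rw [h2]⟩

theorem lie_mem_spC {A B : Matrix (l ⊕ l) (l ⊕ l) ℂ} (hA : A ∈ spC l) (hB : B ∈ spC l) :
    A * B - B * A ∈ spC l :=
  (LieAlgebra.Symplectic.sp l ℂ).lie_mem hA hB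

/-- The map `Z ↦ Z + J Zᵀ J` from all matrices onto `sp`; on `sp` it is multiplication by `2`. -/
def spProj (Z : Matrix (l ⊕ l) (l ⊕ l) ℂ) : Matrix (l ⊕ l) (l ⊕ l) ℂ :=
  Z + Matrix.J l ℂ * Zᵀ * Matrix.J l ℂ

theorem spProj_mem (Z : Matrix (l ⊕ l) (l ⊕ l) ℂ) : spProj Z ∈ spC l := by
  have hJ := J_squared l ℂ
  rw [mem_spC_iff, spProj]
  simp only [transpose_add, transpose_mul, J_transpose, transpose_transpose, Matrix.add_mul,
    Matrix.mul_add, Matrix.neg_mul, Matrix.mul_neg, neg_neg]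
  rw [Matrix.mul_assoc _ (Z * Matrix.J l ℂ), Matrix.mul_assoc Z, hJ,
    Matrix.mul_assoc _ _ (Matrix.J l ℂ), ← Matrix.mul_assoc (Matrix.J l ℂ) (Matrix.J l ℂ), hJ]
  simp

/-- The two summands of `spProj Z` pair equally with an element of `sp` under the trace form. -/
theorem trace_mul_spProj {Y : Matrix (l ⊕ l) (l ⊕ l) ℂ} (hY : Y ∈ spC l)
    (Z : Matrix (l ⊕ l) (l ⊕ l) ℂ) : (Y * spProj Z).trace = 2 * (Y * Z).trace := by
  have hJ := J_squared l ℂ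
  have hY' : Matrix.J l ℂ * Yᵀ * Matrix.J l ℂ = Y := by
    rw [Matrix.mul_assoc, mem_spC_iff.1 hY, Matrix.mul_neg, ← Matrix.mul_assoc, hJ]
    simp
  have h : (Y * (Matrix.J l ℂ * Zᵀ * Matrix.J l ℂ)).trace = (Y * Z).trace := by
    calc (Y * (Matrix.J l ℂ * Zᵀ * Matrix.J l ℂ)).trace
        = (Y * (Matrix.J l ℂ * Zᵀ * Matrix.J l ℂ))ᵀ.trace := (trace_transpose _).symm
      _ = (Matrix.J l ℂ * (Z * Matrix.J l ℂ * Yᵀ)).trace := by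
          congr 1
          simp [transpose_mul, Matrix.mul_assoc]
      _ = (Z * (Matrix.J l ℂ * Yᵀ * Matrix.J l ℂ)).trace := by
          rw [trace_mul_comm]; simp only [Matrix.mul_assoc]
      _ = (Y * Z).trace := by rw [hY', trace_mul_comm]
  rw [spProj, Matrix.mul_add, trace_add, h, two_mul]

/-- The trace form is nondegenerate on `sp`. -/
theorem eq_zero_of_trace_mul_spC {C : Matrix (l ⊕ l) (l ⊕ l) ℂ} (hC : C ∈ spC l)
    (h : ∀ A ∈ spC l, (C * A).trace = 0) : C = 0 := by
  refine ext_iff_trace_mul_right.2 fun Z => ?_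
  have := h _ (spProj_mem Z)
  rw [trace_mul_spProj hC] at this
  simpa using this

/-- A subspace of `sp` whose orthogonal complement in `sp` for the trace form is zero is all
of `sp`. -/
theorem spC_le_of_trace_orthogonal (W : Submodule ℂ (Matrix (l ⊕ l) (l ⊕ l) ℂ)) (hW : W ≤ spC l)
    (h : ∀ Y ∈ spC l, (∀ w ∈ W, (Y * w).trace = 0) → Y = 0) : spC l ≤ W := by
  intro y hy
  by_contra hyW
  obtain ⟨f, hfy, hfW⟩ := W.exists_dual_map_eq_bot_of_notMem hyW inferInstance
  have hf0 : ∀ w ∈ W, f w = 0 := fun w hw => by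
    have : f w ∈ W.map f := Submodule.mem_map_of_mem hw
    rwa [hfW, Submodule.mem_bot] at this
  -- the matrix representing the functional `f` under the trace form
  set Z : Matrix (l ⊕ l) (l ⊕ l) ℂ := Matrix.of fun i j => f (Matrix.single j i 1) with hZ
  have hf : ∀ w, f w = (w * Z).trace := by
    intro w
    conv_lhs => rw [matrix_eq_sum_single w]
    simp only [map_sum, trace, diag_apply, Matrix.mul_apply]
    refine Finset.sum_congr rfl fun i _ => Finset.sum_congr rfl fun j _ => ?_
    rw [show Matrix.single i j (w i j) = w i j • Matrix.single i j (1 : ℂ) by simp, map_smul]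
    simp [hZ]
  have hY : spProj Z = 0 := h _ (spProj_mem Z) fun w hw => by
    rw [trace_mul_comm, trace_mul_spProj (hW hw), ← hf, hf0 w hw, mul_zero]
  apply hfy
  have := trace_mul_spProj hy Z
  rw [hY, Matrix.mul_zero, trace_zero, ← hf] at this
  simpa using this.symm

/-- An element of `sp` orthogonal to `[sp, X]` for the trace form commutes with `X`. -/
theorem commute_of_trace_orthogonal {X Y : Matrix (l ⊕ l) (l ⊕ l) ℂ} (hX : X ∈ spC l)
    (hY : Y ∈ spC l) (h : ∀ A ∈ spC l, (Y * (A * X - X * A)).trace = 0) : X * Y = Y * X := by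
  refine sub_eq_zero.1 (eq_zero_of_trace_mul_spC (lie_mem_spC hX hY) fun A hA => ?_)
  rw [← h A hA, Matrix.sub_mul, Matrix.mul_sub, trace_sub, trace_sub, Matrix.mul_assoc X Y A,
    trace_mul_comm X, Matrix.mul_assoc, Matrix.mul_assoc]

/-! ### The tangent space of an adjoint orbit -/

section

open scoped Matrix.Norms.Operator

theorem exp_mem_symplecticGroup {A : Matrix (l ⊕ l) (l ⊕ l) ℂ} (hA : A ∈ spC l) :
    NormedSpace.exp A ∈ symplecticGroup l ℂ := by
  have hJ := J_squared l ℂ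
  have hJu : IsUnit (Matrix.J l ℂ) := (isUnit_iff_isUnit_det _).2 (isUnit_det_J l ℂ)
  have h1 : Matrix.J l ℂ * Aᵀ * (Matrix.J l ℂ)⁻¹ = -A := by
    rw [J_inv, Matrix.mul_neg, Matrix.mul_assoc, mem_spC_iff.1 hA, Matrix.mul_neg, neg_neg,
      ← Matrix.mul_assoc, hJ, Matrix.neg_mul, Matrix.one_mul]
  have h2 := exp_conj (Matrix.J l ℂ) Aᵀ hJu
  rw [h1, exp_neg] at h2
  have h3 : NormedSpace.exp A * (NormedSpace.exp A)⁻¹ = 1 :=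
    Matrix.mul_nonsing_inv _ ((isUnit_iff_isUnit_det _).1 (isUnit_exp A))
  have h4 : (Matrix.J l ℂ)⁻¹ * Matrix.J l ℂ = 1 :=
    Matrix.nonsing_inv_mul _ (isUnit_det_J l ℂ)
  rw [SymplecticGroup.mem_iff, ← exp_transpose]
  calc NormedSpace.exp A * Matrix.J l ℂ * NormedSpace.exp Aᵀ
      = NormedSpace.exp A * (Matrix.J l ℂ * NormedSpace.exp Aᵀ * (Matrix.J l ℂ)⁻¹) *
          Matrix.J l ℂ := by
        simp only [Matrix.mul_assoc, h4, Matrix.mul_one]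
    _ = Matrix.J l ℂ := by rw [← h2, h3, Matrix.one_mul]

theorem hasDerivAt_exp_smul_apply (A : Matrix (l ⊕ l) (l ⊕ l) ℂ) (t : ℂ) (i j : l ⊕ l) :
    HasDerivAt (fun u : ℂ => NormedSpace.exp (u • A) i j) ((NormedSpace.exp (t • A) * A) i j) t :=
  hasDerivAt_pi.1 (hasDerivAt_pi.1 (hasDerivAt_exp_smul_const (𝕂 := ℂ) A t) i) j

end

theorem hasDerivAt_mul_apply {ι : Type} [Fintype ι] {f g : ℂ → Matrix ι ι ℂ}
    {f' g' : Matrix ι ι ℂ} {t : ℂ}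
    (hf : ∀ i j, HasDerivAt (fun u => f u i j) (f' i j) t)
    (hg : ∀ i j, HasDerivAt (fun u => g u i j) (g' i j) t) (i j : ι) :
    HasDerivAt (fun u => (f u * g u) i j) ((f' * g t + f t * g') i j) t := by
  simp only [Matrix.mul_apply, Matrix.add_apply, ← Finset.sum_add_distrib]
  exact HasDerivAt.fun_sum fun k _ => (hf i k).mul (hg k j)

/-- The map `A ↦ [A, X]`. -/
def adRight (X : Matrix (l ⊕ l) (l ⊕ l) ℂ) :
    Matrix (l ⊕ l) (l ⊕ l) ℂ →ₗ[ℂ] Matrix (l ⊕ l) (l ⊕ l) ℂ :=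
  LinearMap.mulRight ℂ X - LinearMap.mulLeft ℂ X

@[simp]
theorem adRight_apply (X A : Matrix (l ⊕ l) (l ⊕ l) ℂ) : adRight X A = A * X - X * A := rfl

theorem symplecticGroup_inv_mul {g : Matrix (l ⊕ l) (l ⊕ l) ℂ} (hg : g ∈ symplecticGroup l ℂ) :
    g⁻¹ * g = 1 :=
  Matrix.nonsing_inv_mul _ (SymplecticGroup.symplectic_det hg)

/-- The tangent space of the adjoint orbit of `X` is `[sp, X]`: differentiating
`(g X g⁻¹) g = g X` at the identity gives one inclusion, and the one-parameter subgroups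
`t ↦ exp (t A)` give the other. -/
theorem orbitTangent_eq (X : Matrix (l ⊕ l) (l ⊕ l) ℂ) :
    orbitTangent X = (spC l).map (adRight X) := by
  apply le_antisymm
  · refine Submodule.span_le.2 ?_
    rintro v ⟨g, hg, hg0, hd, hv⟩
    set g' : Matrix (l ⊕ l) (l ⊕ l) ℂ := Matrix.of fun i j => deriv (fun t => g t i j) 0
    have hg' : ∀ i j, HasDerivAt (fun t => g t i j) (g' i j) 0 :=
      fun i j => (hd i j 0).hasDerivAt
    have hconst : ∀ (M : Matrix (l ⊕ l) (l ⊕ l) ℂ) (i j : l ⊕ l),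
        HasDerivAt (fun _ : ℂ => M i j) ((0 : Matrix (l ⊕ l) (l ⊕ l) ℂ) i j) 0 :=
      fun M i j => hasDerivAt_const _ _
    refine ⟨g', ?_, ?_⟩
    · have h1 := hasDerivAt_mul_apply (hasDerivAt_mul_apply hg' (hconst (Matrix.J l ℂ)))
        (g := fun t => (g t)ᵀ) (g' := g'ᵀ) (fun i j => hg' j i)
      simp only [SymplecticGroup.mem_iff.1 (hg _), hg0, transpose_one, Matrix.mul_one,
        Matrix.one_mul, Matrix.mul_zero, add_zero] at h1
      have h2 : g' * Matrix.J l ℂ + Matrix.J l ℂ * g'ᵀ = 0 := by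
        ext i j
        exact (h1 i j).unique (hconst (Matrix.J l ℂ) i j)
      have hJ := J_squared l ℂ
      rw [SetLike.mem_coe, mem_spC_iff]
      have h3 := congrArg (fun M => Matrix.J l ℂ * M * Matrix.J l ℂ) h2
      simp only [Matrix.mul_add, Matrix.add_mul, Matrix.mul_zero, Matrix.zero_mul] at h3
      rw [Matrix.mul_assoc, Matrix.mul_assoc, hJ, ← Matrix.mul_assoc (Matrix.J l ℂ) (Matrix.J l ℂ),
        hJ] at h3
      simp only [Matrix.mul_neg, Matrix.mul_one, Matrix.neg_mul, Matrix.one_mul] at h3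
      rw [eq_comm]
      simpa [neg_add_eq_zero, add_eq_zero_iff_eq_neg] using h3
    · have h1 := hasDerivAt_mul_apply hv hg'
      have h2 := hasDerivAt_mul_apply hg' (hconst X)
      have h3 : ∀ t, g t * X * (g t)⁻¹ * g t = g t * X := fun t => by
        rw [Matrix.mul_assoc, symplecticGroup_inv_mul (hg t), Matrix.mul_one]
      simp only [h3, hg0, inv_one, Matrix.mul_one, Matrix.one_mul, Matrix.mul_zero, add_zero]
        at h1 h2
      have h4 : v + X * g' = g' * X := by
        ext i j
        exact (h1 i j).unique (h2 i j)
      rw [adRight_apply, ← h4, add_sub_cancel_right]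
  · rintro _ ⟨A, hA, rfl⟩
    refine Submodule.subset_span ⟨fun t => NormedSpace.exp (t • A),
      fun t => exp_mem_symplecticGroup ((spC l).smul_mem t hA), by simp,
      fun i j t => (hasDerivAt_exp_smul_apply A t i j).differentiableAt, ?_⟩
    have h1 : ∀ i j, HasDerivAt (fun t : ℂ => NormedSpace.exp (t • A) i j) (A i j) 0 :=
      fun i j => by simpa using hasDerivAt_exp_smul_apply A 0 i j
    have h2 : ∀ i j, HasDerivAt (fun t : ℂ => (NormedSpace.exp (t • A))⁻¹ i j) ((-A) i j) 0 := by
      intro i j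
      have := hasDerivAt_exp_smul_apply (-A) 0 i j
      simpa [Matrix.exp_neg] using this
    have hX : ∀ i j, HasDerivAt (fun _ : ℂ => X i j) ((0 : Matrix (l ⊕ l) (l ⊕ l) ℂ) i j) 0 :=
      fun i j => hasDerivAt_const _ _
    intro i j
    have := hasDerivAt_mul_apply (hasDerivAt_mul_apply h1 hX) h2 i j
    simpa [sub_eq_add_neg] using this

end Symplectic

/-! ### Intertwiners of Jordan blocks -/

theorem jordan_mul_apply {M N : ℕ} (Y : Matrix (Fin M) (Fin N) ℂ) (i : Fin M) (j : Fin N) :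
    (jordan M * Y) i j = if h : i.val + 1 < M then Y ⟨i.val + 1, h⟩ j else 0 := by
  rw [Matrix.mul_apply]
  split_ifs with h
  · rw [Finset.sum_eq_single (⟨i.val + 1, h⟩ : Fin M)]
    · simp [jordan]
    · intro b _ hb
      have : i.val + 1 ≠ b.val := fun h' => hb (Fin.ext h'.symm)
      simp [jordan, this]
    · simp
  · refine Finset.sum_eq_zero fun b _ => ?_
    have : i.val + 1 ≠ b.val := by omega
    simp [jordan, this]

theorem mul_jordan_apply {M N : ℕ} (Y : Matrix (Fin M) (Fin N) ℂ) (i : Fin M) (j : Fin N) :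
    (Y * jordan N) i j = if 0 < j.val then Y i ⟨j.val - 1, by omega⟩ else 0 := by
  rw [Matrix.mul_apply]
  split_ifs with h
  · rw [Finset.sum_eq_single (⟨j.val - 1, by omega⟩ : Fin N)]
    · simp [jordan, show j.val - 1 + 1 = j.val by omega]
    · intro b _ hb
      have : b.val + 1 ≠ j.val := fun h' => hb (Fin.ext (by simp; omega))
      simp [jordan, this]
    · simp
  · refine Finset.sum_eq_zero fun b _ => ?_
    have : b.val + 1 ≠ j.val := by omega
    simp [jordan, this]

section Toeplitz

variable {M N : ℕ} {Y : Matrix (Fin M) (Fin N) ℂ} (hY : jordan M * Y = Y * jordan N)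
include hY

theorem intertwiner_apply_add (i j d : ℕ) (hi : i + d < M) (hj : j + d < N) :
    Y ⟨i + d, hi⟩ ⟨j + d, hj⟩ = Y ⟨i, by omega⟩ ⟨j, by omega⟩ := by
  induction d with
  | zero => rfl
  | succ d ih =>
    rw [← ih (by omega) (by omega)]
    have h := congrFun (congrFun hY ⟨i + d, by omega⟩) ⟨j + (d + 1), hj⟩
    rw [jordan_mul_apply, mul_jordan_apply, dif_pos (show i + d + 1 < M by omega),
      if_pos (show 0 < j + (d + 1) by omega)] at h
    exact h

/-- An intertwiner of two Jordan blocks is constant along diagonals. -/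
theorem intertwiner_apply_eq (i i' : Fin M) (j j' : Fin N) (h : i.val + j'.val = i'.val + j.val) :
    Y i j = Y i' j' := by
  rcases le_total i.val i'.val with hi | hi
  · obtain ⟨d, hd⟩ := Nat.exists_eq_add_of_le hi
    have := intertwiner_apply_add hY i.val j.val d (by omega) (by omega)
    rw [← this]
    congr 1 <;> exact Fin.ext (by simp; omega)
  · obtain ⟨d, hd⟩ := Nat.exists_eq_add_of_le hi
    have := intertwiner_apply_add hY i'.val j'.val d (by omega) (by omega)
    rw [← this]
    congr 1 <;> exact Fin.ext (by simp; omega)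

theorem intertwiner_apply_eq_zero_of_lt (i : Fin M) (j : Fin N) (h : j.val < i.val) :
    Y i j = 0 := by
  rw [intertwiner_apply_eq hY i ⟨i.val - j.val, by omega⟩ j ⟨0, by omega⟩ (by simp; omega)]
  have h := congrFun (congrFun hY ⟨i.val - j.val - 1, by omega⟩) ⟨0, by omega⟩
  rw [jordan_mul_apply, mul_jordan_apply, dif_pos (by simp; omega), if_neg (by simp)] at h
  rw [← h]
  congr 1
  exact Fin.ext (by simp; omega)

theorem intertwiner_apply_eq_zero_of_gt (i : Fin M) (j : Fin N) (h : M + j.val < N + i.val) :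
    Y i j = 0 := by
  rw [intertwiner_apply_eq hY i ⟨M - 1, by omega⟩ j ⟨j.val + (M - 1 - i.val), by omega⟩
    (by simp; omega)]
  have h := congrFun (congrFun hY ⟨M - 1, by omega⟩) ⟨j.val + (M - 1 - i.val) + 1, by omega⟩
  rw [jordan_mul_apply, mul_jordan_apply, dif_neg (by simp; omega), if_pos (by simp)] at h
  rw [h]
  rfl

/-- An intertwiner of two Jordan blocks that has a zero entry on every diagonal on which a nonzero
intertwiner can be supported is zero. -/
theorem intertwiner_eq_zero
    (h : ∀ k, k < N → N ≤ M + k → ∃ (i : Fin M) (j : Fin N), j.val = i.val + k ∧ Y i j = 0) :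
    Y = 0 := by
  ext i j
  by_cases h1 : j.val < i.val
  · exact intertwiner_apply_eq_zero_of_lt hY i j h1
  by_cases h2 : M + j.val < N + i.val
  · exact intertwiner_apply_eq_zero_of_gt hY i j h2
  obtain ⟨i', j', h3, h4⟩ := h (j.val - i.val) (by omega) (by omega)
  rw [intertwiner_apply_eq hY i i' j j' (by omega), h4, Matrix.zero_apply]

end Toeplitz

/-- The matrix with ones on the `k`-th diagonal. -/
def diagShift (N M k : ℕ) : Matrix (Fin N) (Fin M) ℂ :=
  Matrix.of fun j i => if i.val = j.val + k then 1 else 0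

theorem jordan_mul_diagShift {N M k : ℕ} (h : M ≤ N + k) :
    jordan N * diagShift N M k = diagShift N M k * jordan M := by
  ext j i
  rw [jordan_mul_apply, mul_jordan_apply]
  simp only [diagShift, of_apply]
  split_ifs <;> first | rfl | omega

/-- If `A J - J A` has at most one nonzero entry on a diagonal supporting intertwiners, then that
entry vanishes: the sum of the entries on the diagonal is the trace of the product with an
intertwiner. -/
theorem apply_eq_zero_of_eq_mul_jordan_sub {M N : ℕ} {v A : Matrix (Fin M) (Fin N) ℂ}
    (hv : v = A * jordan N - jordan M * A) (i₀ : Fin M) (j₀ : Fin N) (k : ℕ)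
    (hk : i₀.val = j₀.val + k) (hMN : M ≤ N + k)
    (h : ∀ i j, i.val = j.val + k → v i j ≠ 0 → i = i₀) : v i₀ j₀ = 0 := by
  have h0 : (v * diagShift N M k).trace = 0 := by
    rw [hv, Matrix.sub_mul, trace_sub, Matrix.mul_assoc, jordan_mul_diagShift hMN,
      Matrix.mul_assoc, trace_mul_comm (jordan M), Matrix.mul_assoc, sub_self]
  rw [← h0, trace, Finset.sum_eq_single i₀]
  · rw [diag_apply, Matrix.mul_apply, Finset.sum_eq_single j₀]
    · simp [diagShift, hk]
    · intro j _ hj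
      have : ¬ i₀.val = j.val + k := fun h' => hj (Fin.ext (by omega))
      simp [diagShift, this]
    · simp
  · intro i _ hi
    rw [diag_apply, Matrix.mul_apply]
    refine Finset.sum_eq_zero fun j _ => ?_
    by_cases h1 : i.val = j.val + k
    · have : v i j = 0 := by
        by_contra hne
        exact hi (h i j h1 hne)
      rw [this, zero_mul]
    · simp [diagShift, h1]
  · simp

/-! ### Chain coordinates -/

/-- The position of the basis vectors of `ℂ^k ⊕ ℂ^k` in the Jordan chain of the block
`[[J_k, 𝓔_k], [0, -J_kᵀ]]`: the vectors `e_1, …, e_k` are followed by `f_k, …, f_1`. -/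
def chainPos (k : ℕ) : Fin k ⊕ Fin k ≃ Fin (2 * k) where
  toFun := Sum.elim (fun i => ⟨i.val, by omega⟩) (fun i => ⟨2 * k - 1 - i.val, by omega⟩)
  invFun j := if h : j.val < k then Sum.inl ⟨j.val, h⟩
    else Sum.inr ⟨2 * k - 1 - j.val, by omega⟩
  left_inv := by
    rintro (i | i)
    · simp
    · have h1 : ¬ 2 * k - 1 - i.val < k := by omega
      have h2 : 2 * k - 1 - (2 * k - 1 - i.val) = i.val := by omega
      simp [h1, h2]
  right_inv := by
    intro j
    by_cases h : j.val < k
    · simp [h]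
    · have h2 : 2 * k - 1 - (2 * k - 1 - j.val) = j.val := by omega
      simp [h, h2]

variable (m n : ℕ)

/-- The positions of the basis vectors in the two Jordan chains of `X_n`. -/
def chainEquiv : Idx m n ⊕ Idx m n ≃ Fin (2 * (m - n)) ⊕ Fin (2 * n) :=
  (Equiv.sumSumSumComm _ _ _ _).trans (Equiv.sumCongr (chainPos (m - n)) (chainPos n))

variable {m n}

@[simp] theorem chainEquiv_inl_inl (i : Fin (m - n)) :
    chainEquiv m n (Sum.inl (Sum.inl i)) = Sum.inl ⟨i.val, by omega⟩ := rfl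
@[simp] theorem chainEquiv_inl_inr (i : Fin n) :
    chainEquiv m n (Sum.inl (Sum.inr i)) = Sum.inr ⟨i.val, by omega⟩ := rfl
@[simp] theorem chainEquiv_inr_inl (i : Fin (m - n)) :
    chainEquiv m n (Sum.inr (Sum.inl i)) = Sum.inl ⟨2 * (m - n) - 1 - i.val, by omega⟩ := rfl
@[simp] theorem chainEquiv_inr_inr (i : Fin n) :
    chainEquiv m n (Sum.inr (Sum.inr i)) = Sum.inr ⟨2 * n - 1 - i.val, by omega⟩ := rfl

/-- The signs by which the basis vectors have to be multiplied to form Jordan chains of `X_n`. -/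
def chainSign : Idx m n ⊕ Idx m n → ℂ :=
  Sum.elim (fun _ => 1)
    (Sum.elim (fun i => (-1) ^ (m - n - 1 - i.val)) (fun i => (-1) ^ (n - 1 - i.val)))

theorem chainSign_mul_self (a : Idx m n ⊕ Idx m n) : chainSign a * chainSign a = 1 := by
  rcases a with (a | (a | a)) <;> simp [chainSign, ← mul_pow]

theorem chainSign_ne_zero (a : Idx m n ⊕ Idx m n) : chainSign a ≠ 0 :=
  left_ne_zero_of_mul_eq_one (chainSign_mul_self a)

/-- The matrix of an endomorphism in the basis formed by the two Jordan chains of `X_n`. -/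
def chainForm (Y : Mat m n) :
    Matrix (Fin (2 * (m - n)) ⊕ Fin (2 * n)) (Fin (2 * (m - n)) ⊕ Fin (2 * n)) ℂ :=
  (diagonal chainSign * Y * diagonal chainSign).submatrix (chainEquiv m n).symm
    (chainEquiv m n).symm

@[simp]
theorem chainForm_apply (Y : Mat m n) (a b : Idx m n ⊕ Idx m n) :
    chainForm Y (chainEquiv m n a) (chainEquiv m n b) = chainSign a * Y a b * chainSign b := by
  simp [chainForm, Matrix.mul_diagonal, Matrix.diagonal_mul]

theorem chainForm_apply_eq_zero_iff (Y : Mat m n) (a b : Idx m n ⊕ Idx m n) :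
    chainForm Y (chainEquiv m n a) (chainEquiv m n b) = 0 ↔ Y a b = 0 := by
  simp [chainSign_ne_zero]

theorem diagonal_chainSign_mul_self :
    (diagonal chainSign * diagonal chainSign : Mat m n) = 1 := by
  rw [diagonal_mul_diagonal]
  simp [chainSign_mul_self]

theorem chainForm_mul (Y Z : Mat m n) : chainForm (Y * Z) = chainForm Y * chainForm Z := by
  rw [chainForm, chainForm, chainForm, submatrix_mul_equiv]
  congr 1
  simp only [Matrix.mul_assoc]
  rw [← Matrix.mul_assoc (diagonal chainSign) (diagonal chainSign), diagonal_chainSign_mul_self,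
    Matrix.one_mul]

theorem chainForm_sub (Y Z : Mat m n) : chainForm (Y - Z) = chainForm Y - chainForm Z := by
  simp only [chainForm, Matrix.mul_sub, Matrix.sub_mul]
  rfl

theorem neg_one_pow_mul_pow_succ (r : ℕ) : (-1 : ℂ) ^ r * (-1) ^ (r + 1) = -1 := by
  rw [pow_succ, ← mul_assoc, ← mul_pow]
  simp

/-- In its two chains `X_n` acts by the two nilpotent Jordan blocks. -/
theorem chainForm_nilX :
    chainForm (nilX m n) = fromBlocks (jordan (2 * (m - n))) 0 0 (jordan (2 * n)) := by
  have key : ∀ a b : Idx m n ⊕ Idx m n, chainSign a * nilX m n a b * chainSign b =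
      fromBlocks (jordan (2 * (m - n))) 0 0 (jordan (2 * n)) (chainEquiv m n a)
        (chainEquiv m n b) := by
    have hneg : ∀ k i j : ℕ, i < k → j < k →
        -((-1 : ℂ) ^ (k - 1 - i) * (if j + 1 = i then 1 else 0) * (-1) ^ (k - 1 - j)) =
          if 2 * k - 1 - i + 1 = 2 * k - 1 - j then 1 else 0 := by
      intro k i j hi hj
      by_cases h : j + 1 = i
      · rw [if_pos h, if_pos (by omega), mul_one, show k - 1 - j = k - 1 - i + 1 by omega,
          neg_one_pow_mul_pow_succ, neg_neg]
      · rw [if_neg h, if_neg (by omega)]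
        simp
    rintro ((a | a) | (a | a)) ((b | b) | (b | b)) <;>
      simp only [chainEquiv_inl_inl, chainEquiv_inl_inr, chainEquiv_inr_inl, chainEquiv_inr_inr,
        nilX, fromBlocks_apply₁₁, fromBlocks_apply₁₂, fromBlocks_apply₂₁, fromBlocks_apply₂₂,
        Matrix.zero_apply, mul_zero, zero_mul, Matrix.neg_apply, transpose_apply, mul_neg, neg_mul]
    · simp [chainSign, jordan]
    · simp only [chainSign, Sum.elim_inl, Sum.elim_inr, corner, of_apply, jordan]
      by_cases h : a.val + 1 = m - n ∧ b.val + 1 = m - n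
      · rw [if_pos h, if_pos (by omega), show m - n - 1 - b.val = 0 by omega]; simp
      · rw [if_neg h, if_neg (by omega)]; simp
    · simp [chainSign, jordan]
    · simp only [chainSign, Sum.elim_inl, Sum.elim_inr, corner, of_apply, jordan]
      by_cases h : a.val + 1 = n ∧ b.val + 1 = n
      · rw [if_pos h, if_pos (by omega), show n - 1 - b.val = 0 by omega]; simp
      · rw [if_neg h, if_neg (by omega)]; simp
    · simp only [jordan, of_apply]
      rw [if_neg (by omega)]
    · simp only [jordan, of_apply]
      exact hneg _ _ _ a.2 b.2
    · simp only [jordan, of_apply]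
      rw [if_neg (by omega)]
    · simp only [jordan, of_apply]
      exact hneg _ _ _ a.2 b.2
  ext k l
  obtain ⟨a, rfl⟩ := (chainEquiv m n).surjective k
  obtain ⟨b, rfl⟩ := (chainEquiv m n).surjective l
  rw [chainForm_apply, key]

theorem hasPartition_nilX (m n : ℕ) : HasPartition (nilX m n) (2 * (m - n)) (2 * n) := by
  have hD := diagonal_chainSign_mul_self (m := m) (n := n)
  refine ⟨(diagonal chainSign : Mat m n).submatrix id (chainEquiv m n).symm,
    (diagonal chainSign : Mat m n).submatrix (chainEquiv m n).symm id, ?_, ?_, ?_⟩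
  · rw [submatrix_mul_equiv, hD, submatrix_one _ Function.injective_id]
  · rw [← submatrix_mul _ _ _ id _ Function.bijective_id, hD, submatrix_one_equiv]
  · rw [← chainForm_nilX, chainForm, submatrix_mul_equiv, ← Matrix.mul_assoc, ← Matrix.mul_assoc,
      hD, Matrix.one_mul]
    rfl

/-! ### The symplectic Lie algebra in chain coordinates -/

theorem spC_apply_swap {Y : Mat m n} (hY : Y ∈ spC (Idx m n)) (a b : Idx m n ⊕ Idx m n) :
    Y a b = -((Sum.elim (fun _ => 1) (fun _ => -1) a : ℂ) * Sum.elim (fun _ => 1) (fun _ => -1) b *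
      Y b.swap a.swap) := by
  rw [← fromBlocks_toBlocks Y, fromBlocks_mem_spC_iff] at hY
  obtain ⟨h1, h2, h3⟩ := hY
  rcases a with a | a <;> rcases b with b | b
  · have := congrFun (congrFun h1 b) a
    simp only [toBlocks₂₂, toBlocks₁₁, of_apply, Matrix.neg_apply, transpose_apply] at this
    simp [this]
  · have := congrFun (congrFun h2 a) b
    simp only [toBlocks₁₂, of_apply, transpose_apply] at this
    simp [this]
  · have := congrFun (congrFun h3 a) b
    simp only [toBlocks₂₁, of_apply, transpose_apply] at this
    simp [this]
  · have := congrFun (congrFun h1 a) b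
    simp only [toBlocks₂₂, toBlocks₁₁, of_apply, Matrix.neg_apply, transpose_apply] at this
    simp [this]

/-! ### The direction of the slice -/

/-- The positions, in chain coordinates, of the matrix entries that vary in the slice: those of the
`d_j` and `a_j` in the two diagonal blocks, those of the `y_j`, of the `z_j` and, if `m = 2n`, of
`z_n` in the third case, and their images under the symplectic form in the last. Each diagonal
of a block on which matrices commuting with `X_n` can be supported is met exactly once, except for
the even diagonals in the diagonal blocks, which `sp` excludes. -/
def sliceSupport (m n : ℕ) :
    Fin (2 * (m - n)) ⊕ Fin (2 * n) → Fin (2 * (m - n)) ⊕ Fin (2 * n) → Prop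
  | Sum.inl i, Sum.inl j => i.val + j.val + 1 = 2 * (m - n) ∧ j.val < m - n
  | Sum.inr i, Sum.inr j => i.val + j.val + 1 = 2 * n ∧ j.val < n
  | Sum.inl i, Sum.inr j => (i.val + 1 = 2 * (m - n) ∧ j.val < n) ∨
      (j.val + 1 = n ∧ m - n ≤ i.val ∧ i.val + 1 < 2 * (m - n) ∧ 2 * (m - n) ≤ i.val + n + 1) ∨
      (m = 2 * n ∧ i.val = m - n ∧ j.val = n)
  | Sum.inr i, Sum.inl j => (j.val = 0 ∧ n ≤ i.val) ∨
      (i.val = n ∧ j.val < m - n ∧ 0 < j.val ∧ j.val ≤ n) ∨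
      (m = 2 * n ∧ i.val + 1 = n ∧ j.val + 1 = m - n)

theorem sliceSupport_swap {a b : Idx m n ⊕ Idx m n}
    (h : sliceSupport m n (chainEquiv m n a) (chainEquiv m n b)) :
    sliceSupport m n (chainEquiv m n b.swap) (chainEquiv m n a.swap) := by
  rcases a with ((a | a) | (a | a)) <;> rcases b with ((b | b) | (b | b)) <;>
    simp only [Sum.swap_inl, Sum.swap_inr, chainEquiv_inl_inl, chainEquiv_inl_inr,
      chainEquiv_inr_inl, chainEquiv_inr_inr, sliceSupport] at h ⊢ <;> omega

variable (m n) in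
/-- The elements of `sp` supported on the positions that vary in the slice. -/
def sliceDirection : Submodule ℂ (Mat m n) where
  carrier := {v | v ∈ spC (Idx m n) ∧
    ∀ a b, ¬ sliceSupport m n (chainEquiv m n a) (chainEquiv m n b) → v a b = 0}
  add_mem' := fun hv hw => ⟨add_mem hv.1 hw.1, fun a b h => by
    rw [Matrix.add_apply, hv.2 a b h, hw.2 a b h, add_zero]⟩
  zero_mem' := ⟨zero_mem _, fun _ _ _ => rfl⟩
  smul_mem' := fun c v hv => ⟨(spC _).smul_mem c hv.1, fun a b h => by
    rw [Matrix.smul_apply, hv.2 a b h, smul_zero]⟩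

theorem corner_transpose (k : ℕ) : (corner k)ᵀ = corner k := by
  ext i j
  simp [corner, and_comm]

theorem nilX_mem_spC : nilX m n ∈ spC (Idx m n) := by
  rw [nilX, fromBlocks_mem_spC_iff, fromBlocks_transpose, fromBlocks_neg, fromBlocks_transpose]
  simp [corner_transpose]

/-- The matrix with `ζ` in the position of `E_{m,n}` and zeros elsewhere. -/
def cornerShift (ζ : ℂ) : Matrix (Idx m n) (Idx m n) ℂ :=
  fromBlocks 0 0 (Matrix.of fun i j => if i.val + 1 = n ∧ j.val + 1 = m - n then ζ else 0) 0

/-- The coefficient of `E_{m,n} - E_{m+n,2m}` in `S(a, y, z, d)`. -/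
def shiftCoeff (m : ℕ) {n : ℕ} (z : Fin n → ℂ) : ℂ := if m = 2 * n then zLast z else 0

/-- Both cases of the definition of `S(a, y, z, d)` in a single formula. -/
theorem sliceS_eq (a y z : Fin n → ℂ) (d : Fin (m - n) → ℂ) :
    sliceS a y z d = nilX m n + fromBlocks (cornerShift (shiftCoeff m z)) 0
      (lowerM a y z d - fromBlocks ((shiftCoeff m z) ^ 2 • corner (m - n)) 0 0 0)
      (-(cornerShift (shiftCoeff m z))ᵀ) := by
  have h0 : cornerShift (m := m) (n := n) 0 = 0 := by
    rw [cornerShift, ← fromBlocks_zero]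
    congr 1
    ext i j
    simp
  by_cases h : m = 2 * n
  · simp only [sliceS, shiftCoeff, if_pos h]
    rfl
  · simp [sliceS, shiftCoeff, if_neg h, h0]

theorem crossBlock_apply (y z : Fin n → ℂ) (i : Fin (m - n)) (k : Fin n) :
    crossBlock y z i k = (if i.val = 0 then y k else 0) +
      if h : 0 < i.val ∧ i.val ≤ n ∧ k.val + 1 = n then z ⟨i.val - 1, by omega⟩ else 0 := by
  rw [crossBlock, of_apply]
  congr 1
  split_ifs with h
  · rw [Finset.sum_eq_single (⟨i.val - 1, by omega⟩ : Fin n)]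
    · rw [if_pos ⟨by simp; omega, h.2.2⟩]
    · intro j _ hj
      rw [if_neg]
      rintro ⟨h1, -⟩
      exact hj (Fin.ext (by simp; omega))
    · simp
  · refine Finset.sum_eq_zero fun j _ => ?_
    rw [if_neg]
    rintro ⟨h1, h2⟩
    exact h ⟨by omega, by omega, h2⟩

theorem lowerM_transpose (a y z : Fin n → ℂ) (d : Fin (m - n) → ℂ) :
    (lowerM a y z d)ᵀ = lowerM a y z d := by
  rw [lowerM, fromBlocks_transpose]
  simp

theorem sliceS_sub_nilX_mem (a y z : Fin n → ℂ) (d : Fin (m - n) → ℂ) :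
    sliceS a y z d - nilX m n ∈ sliceDirection m n := by
  rw [sliceS_eq, add_sub_cancel_left]
  refine ⟨?_, ?_⟩
  · rw [fromBlocks_mem_spC_iff]
    refine ⟨rfl, by simp, ?_⟩
    rw [transpose_sub, lowerM_transpose, fromBlocks_transpose]
    simp [corner_transpose]
  · have hs : ∀ (i : Fin n) (j : Fin (m - n)), ¬ (m = 2 * n ∧ i.val + 1 = n ∧ j.val + 1 = m - n) →
        (if i.val + 1 = n ∧ j.val + 1 = m - n then shiftCoeff m z else 0) = 0 := by
      intro i j h
      split_ifs with h'
      · rw [shiftCoeff, if_neg (fun h1 => h ⟨h1, h'⟩)]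
      · rfl
    have hcross : ∀ (i : Fin (m - n)) (j : Fin n),
        ¬ (i.val = 0 ∨ (0 < i.val ∧ i.val ≤ n ∧ j.val + 1 = n)) → crossBlock y z i j = 0 := by
      intro i j h
      rw [crossBlock_apply, if_neg (fun h' => h (Or.inl h')), dif_neg (fun h' => h (Or.inr h')),
        add_zero]
    rintro ((i | i) | (i | i)) ((j | j) | (j | j)) h <;>
      simp only [chainEquiv_inl_inl, chainEquiv_inl_inr, chainEquiv_inr_inl, chainEquiv_inr_inr,
        sliceSupport] at h <;>
      simp only [cornerShift, lowerM, fromBlocks_apply₁₁, fromBlocks_apply₁₂, fromBlocks_apply₂₁,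
        fromBlocks_apply₂₂, Matrix.zero_apply, Matrix.neg_apply, Matrix.sub_apply, transpose_apply,
        of_apply, neg_zero, sub_zero]
    · exact hs _ _ (by omega)
    · have hij : i ≠ j := by
        rintro rfl
        omega
      have hc : ¬ (i.val + 1 = m - n ∧ j.val + 1 = m - n) := fun h' => hij (Fin.ext (by omega))
      simp [hij, corner, hc]
    · exact hcross _ _ (by omega)
    · rw [hs _ _ (by omega), neg_zero]
    · exact hcross _ _ (by omega)
    · have hij : i ≠ j := by
        rintro rfl
        omega
      simp [hij]

theorem exists_sliceS_of_mem (hn : 2 * n ≤ m) {v : Mat m n} (hv : v ∈ sliceDirection m n) :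
    ∃ a y z d, nilX m n + v = sliceS a y z d := by
  obtain ⟨hsp, h0⟩ := hv
  -- the value of the coefficient `ζ` of `E_{m,n} - E_{m+n,2m}`, if `m = 2n > 0`
  set ζ : ℂ := if h : 0 < n then
    v (Sum.inl (Sum.inr ⟨n - 1, by omega⟩)) (Sum.inl (Sum.inl ⟨m - n - 1, by omega⟩)) else 0
    with hζ
  set z : Fin n → ℂ := fun j => if h : j.val + 1 < m - n then
    v (Sum.inr (Sum.inl ⟨j.val + 1, h⟩)) (Sum.inl (Sum.inr ⟨n - 1, by have := j.2; omega⟩)) else ζ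
    with hz
  set y : Fin n → ℂ := fun k =>
    v (Sum.inr (Sum.inl ⟨0, by have := k.2; omega⟩)) (Sum.inl (Sum.inr k)) with hy
  set a : Fin n → ℂ := fun j =>
    v (Sum.inr (Sum.inr j.rev)) (Sum.inl (Sum.inr j.rev)) with ha
  set d : Fin (m - n) → ℂ := fun j =>
    v (Sum.inr (Sum.inl j.rev)) (Sum.inl (Sum.inl j.rev)) +
      if j.val = 0 then shiftCoeff m z ^ 2 else 0 with hd
  have hshift : ∀ h : 0 < n, m = 2 * n → shiftCoeff m z =
      v (Sum.inl (Sum.inr ⟨n - 1, by omega⟩)) (Sum.inl (Sum.inl ⟨m - n - 1, by omega⟩)) := by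
    intro h hm
    rw [shiftCoeff, if_pos hm, zLast, Finset.sum_eq_single (⟨n - 1, by omega⟩ : Fin n)]
    · rw [if_pos (by simp; omega), hz]
      simp only
      rw [dif_neg (by omega), hζ, dif_pos h]
    · intro j _ hj
      rw [if_neg]
      intro h1
      exact hj (Fin.ext (by simp; omega))
    · simp
  refine ⟨a, y, z, d, ?_⟩
  rw [sliceS_eq]
  congr 1
  rw [← fromBlocks_toBlocks v] at hsp ⊢
  rw [fromBlocks_mem_spC_iff] at hsp
  obtain ⟨h1, h2, h3⟩ := hsp
  have hP : v.toBlocks₁₁ = cornerShift (shiftCoeff m z) := by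
    ext i j
    rcases i with i | i <;> rcases j with j | j
    · refine h0 _ _ ?_
      simp only [chainEquiv_inl_inl, sliceSupport]
      omega
    · refine h0 _ _ ?_
      simp only [chainEquiv_inl_inl, chainEquiv_inl_inr, sliceSupport]
      omega
    · simp only [cornerShift, fromBlocks_apply₂₁, of_apply]
      by_cases hm : m = 2 * n
      · split_ifs with h
        · rw [hshift (by omega) hm]
          simp only [toBlocks₁₁, of_apply]
          congr 3 <;> exact Fin.ext (by simp; omega)
        · refine h0 _ _ ?_
          simp only [chainEquiv_inl_inl, chainEquiv_inl_inr, sliceSupport]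
          omega
      · rw [shiftCoeff, if_neg hm, ite_self]
        refine h0 _ _ ?_
        simp only [chainEquiv_inl_inl, chainEquiv_inl_inr, sliceSupport]
        omega
    · refine h0 _ _ ?_
      simp only [chainEquiv_inl_inr, sliceSupport]
      omega
  have hQ : v.toBlocks₁₂ = 0 := by
    ext i j
    rcases i with i | i <;> rcases j with j | j <;> refine h0 _ _ ?_ <;>
      simp only [chainEquiv_inl_inl, chainEquiv_inl_inr, chainEquiv_inr_inl, chainEquiv_inr_inr,
        sliceSupport] <;> omega
  have hcross : ∀ (i : Fin (m - n)) (j : Fin n),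
      v (Sum.inr (Sum.inl i)) (Sum.inl (Sum.inr j)) = crossBlock y z i j := by
    intro i j
    rw [crossBlock_apply]
    by_cases hi : i.val = 0
    · rw [if_pos hi, dif_neg (by omega), add_zero, hy]
      simp only
      congr 3
      exact Fin.ext hi
    · rw [if_neg hi, zero_add]
      split_ifs with h
      · rw [hz]
        simp only
        rw [dif_pos (by omega)]
        congr 3 <;> exact Fin.ext (by simp; omega)
      · refine h0 _ _ ?_
        simp only [chainEquiv_inl_inr, chainEquiv_inr_inl, sliceSupport]
        omega
  have hR : v.toBlocks₂₁ =
      lowerM a y z d - fromBlocks ((shiftCoeff m z) ^ 2 • corner (m - n)) 0 0 0 := by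
    ext i j
    rcases i with i | i <;> rcases j with j | j
    · simp only [lowerM, Matrix.sub_apply, fromBlocks_apply₁₁, toBlocks₂₁, of_apply]
      by_cases hij : i = j
      · subst hij
        rw [diagonal_apply_eq, hd]
        simp only [Fin.rev_rev, Matrix.smul_apply, corner, of_apply, smul_eq_mul, Fin.val_rev]
        by_cases h : i.val + 1 = m - n
        · rw [if_pos (by omega), if_pos ⟨h, h⟩]; ring
        · rw [if_neg (by omega), if_neg (by omega)]; ring
      · rw [diagonal_apply_ne _ hij]
        have hc : ¬ (i.val + 1 = m - n ∧ j.val + 1 = m - n) := fun h' => hij (Fin.ext (by omega))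
        have hij' : i.val ≠ j.val := fun h => hij (Fin.ext h)
        simp only [Matrix.smul_apply, corner, of_apply, if_neg hc, smul_zero, sub_zero]
        refine h0 _ _ ?_
        simp only [chainEquiv_inl_inl, chainEquiv_inr_inl, sliceSupport]
        omega
    · simp only [lowerM, Matrix.sub_apply, fromBlocks_apply₁₂, toBlocks₂₁, of_apply,
        Matrix.zero_apply, sub_zero]
      exact hcross i j
    · rw [← h3]
      simp only [lowerM, Matrix.sub_apply, fromBlocks_apply₂₁, toBlocks₂₁, of_apply,
        Matrix.zero_apply, sub_zero, transpose_apply]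
      exact hcross j i
    · simp only [lowerM, Matrix.sub_apply, fromBlocks_apply₂₂, toBlocks₂₁, of_apply,
        Matrix.zero_apply, sub_zero]
      by_cases hij : i = j
      · subst hij
        rw [diagonal_apply_eq, ha]
        simp
      · rw [diagonal_apply_ne _ hij]
        have hij' : i.val ≠ j.val := fun h => hij (Fin.ext h)
        refine h0 _ _ ?_
        simp only [chainEquiv_inl_inr, chainEquiv_inr_inr, sliceSupport]
        omega
  rw [h1, hP, hQ, hR]

/-- The slice is the affine subspace through `X_n` with direction `sliceDirection`. -/
theorem mem_slice_iff (hn : 2 * n ≤ m) (Y : Mat m n) :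
    Y ∈ slice m n ↔ Y - nilX m n ∈ sliceDirection m n := by
  constructor
  · rintro ⟨a, y, z, d, rfl⟩
    exact sliceS_sub_nilX_mem a y z d
  · intro h
    obtain ⟨a, y, z, d, h⟩ := exists_sliceS_of_mem hn h
    rw [add_sub_cancel] at h
    exact ⟨a, y, z, d, h⟩

/-! ### Transversality -/

/-- The block entries of the identity `[A, X_n] = v` in chain coordinates. -/
theorem toBlocks_eq_of_eq_lie {v A : Mat m n} (h : v = A * nilX m n - nilX m n * A) :
    ((chainForm v).toBlocks₁₁ = (chainForm A).toBlocks₁₁ * jordan (2 * (m - n)) -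
      jordan (2 * (m - n)) * (chainForm A).toBlocks₁₁ ∧
    (chainForm v).toBlocks₁₂ = (chainForm A).toBlocks₁₂ * jordan (2 * n) -
      jordan (2 * (m - n)) * (chainForm A).toBlocks₁₂) ∧
    (chainForm v).toBlocks₂₁ = (chainForm A).toBlocks₂₁ * jordan (2 * (m - n)) -
      jordan (2 * n) * (chainForm A).toBlocks₂₁ ∧
    (chainForm v).toBlocks₂₂ = (chainForm A).toBlocks₂₂ * jordan (2 * n) -
      jordan (2 * n) * (chainForm A).toBlocks₂₂ := by
  have h1 : chainForm v = chainForm A * chainForm (nilX m n) -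
      chainForm (nilX m n) * chainForm A := by
    rw [h, chainForm_sub, chainForm_mul, chainForm_mul]
  rw [chainForm_nilX, ← fromBlocks_toBlocks (chainForm A), fromBlocks_multiply,
    fromBlocks_multiply, sub_eq_add_neg, fromBlocks_neg, fromBlocks_add] at h1
  rw [h1]
  simp [sub_eq_add_neg]

theorem eq_zero_of_chainForm {Y : Mat m n} (h11 : (chainForm Y).toBlocks₁₁ = 0)
    (h12 : (chainForm Y).toBlocks₁₂ = 0) (h21 : (chainForm Y).toBlocks₂₁ = 0)
    (h22 : (chainForm Y).toBlocks₂₂ = 0) : Y = 0 := by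
  have h : chainForm Y = 0 := by
    rw [← fromBlocks_toBlocks (chainForm Y), h11, h12, h21, h22, fromBlocks_zero]
  ext a b
  exact (chainForm_apply_eq_zero_iff Y a b).1 (by rw [h]; rfl)

/-- The basis vector at position `i` of the first chain is paired by the symplectic form with the
one at position `2 (m - n) - 1 - i`. -/
theorem chainEquiv_swap_inl {a : Idx m n ⊕ Idx m n} {i : Fin (2 * (m - n))}
    (h : chainEquiv m n a = Sum.inl i) : chainEquiv m n a.swap = Sum.inl i.rev := by
  rcases a with ((a | a) | (a | a)) <;>
    simp only [Sum.swap_inl, Sum.swap_inr, chainEquiv_inl_inl, chainEquiv_inl_inr,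
      chainEquiv_inr_inl, chainEquiv_inr_inr, Sum.inl.injEq, reduceCtorEq] at h ⊢ <;>
    subst h <;> exact Fin.ext (by simp [Fin.val_rev]; omega)

theorem chainEquiv_swap_inr {a : Idx m n ⊕ Idx m n} {i : Fin (2 * n)}
    (h : chainEquiv m n a = Sum.inr i) : chainEquiv m n a.swap = Sum.inr i.rev := by
  rcases a with ((a | a) | (a | a)) <;>
    simp only [Sum.swap_inl, Sum.swap_inr, chainEquiv_inl_inl, chainEquiv_inl_inr,
      chainEquiv_inr_inl, chainEquiv_inr_inr, Sum.inr.injEq, reduceCtorEq] at h ⊢ <;>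
    subst h <;> exact Fin.ext (by simp [Fin.val_rev]; omega)

theorem apply_swap_eq_zero {Y : Mat m n} (hY : Y ∈ spC (Idx m n)) {a b : Idx m n ⊕ Idx m n}
    (h : Y b.swap a.swap = 0) : Y a b = 0 := by
  rw [spC_apply_swap hY, h, mul_zero, neg_zero]

theorem toBlocks₁₂_chainForm_eq_zero {Y : Mat m n} (hY : Y ∈ spC (Idx m n))
    (h : (chainForm Y).toBlocks₂₁ = 0) : (chainForm Y).toBlocks₁₂ = 0 := by
  ext i j
  obtain ⟨a, ha⟩ := (chainEquiv m n).surjective (Sum.inl i)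
  obtain ⟨b, hb⟩ := (chainEquiv m n).surjective (Sum.inr j)
  change chainForm Y (Sum.inl i) (Sum.inr j) = 0
  rw [← ha, ← hb, chainForm_apply_eq_zero_iff]
  apply apply_swap_eq_zero hY
  rw [← chainForm_apply_eq_zero_iff, chainEquiv_swap_inl ha, chainEquiv_swap_inr hb]
  exact congrFun (congrFun h j.rev) i.rev

theorem toBlocks₂₁_chainForm_eq_zero {Y : Mat m n} (hY : Y ∈ spC (Idx m n))
    (h : (chainForm Y).toBlocks₁₂ = 0) : (chainForm Y).toBlocks₂₁ = 0 := by
  ext i j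
  obtain ⟨a, ha⟩ := (chainEquiv m n).surjective (Sum.inr i)
  obtain ⟨b, hb⟩ := (chainEquiv m n).surjective (Sum.inl j)
  change chainForm Y (Sum.inr i) (Sum.inl j) = 0
  rw [← ha, ← hb, chainForm_apply_eq_zero_iff]
  apply apply_swap_eq_zero hY
  rw [← chainForm_apply_eq_zero_iff, chainEquiv_swap_inr ha, chainEquiv_swap_inl hb]
  exact congrFun (congrFun h j.rev) i.rev

theorem support_of_chainForm_ne_zero {v : Mat m n} (hv : v ∈ sliceDirection m n)
    {k l : Fin (2 * (m - n)) ⊕ Fin (2 * n)} (h : chainForm v k l ≠ 0) : sliceSupport m n k l := by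
  obtain ⟨a, rfl⟩ := (chainEquiv m n).surjective k
  obtain ⟨b, rfl⟩ := (chainEquiv m n).surjective l
  by_contra hs
  exact h ((chainForm_apply_eq_zero_iff v a b).2 (hv.2 a b hs))

theorem disjoint_sliceDirection (hn : 2 * n ≤ m) {v A : Mat m n} (hv : v ∈ sliceDirection m n)
    (h : v = A * nilX m n - nilX m n * A) : v = 0 := by
  obtain ⟨⟨h11, h12⟩, -, h22⟩ := toBlocks_eq_of_eq_lie h
  have z12 : (chainForm v).toBlocks₁₂ = 0 := by
    ext i j
    by_contra hne
    have hs := support_of_chainForm_ne_zero hv hne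
    simp only [sliceSupport] at hs
    refine hne (apply_eq_zero_of_eq_mul_jordan_sub h12 i j (i.val - j.val) (by omega) (by omega)
      fun i' j' h' hne' => ?_)
    have hs' := support_of_chainForm_ne_zero hv hne'
    simp only [sliceSupport] at hs'
    exact Fin.ext (by omega)
  refine eq_zero_of_chainForm ?_ z12 (toBlocks₂₁_chainForm_eq_zero hv.1 z12) ?_
  · ext i j
    by_contra hne
    have hs := support_of_chainForm_ne_zero hv hne
    simp only [sliceSupport] at hs
    refine hne (apply_eq_zero_of_eq_mul_jordan_sub h11 i j (i.val - j.val) (by omega) (by omega)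
      fun i' j' h' hne' => ?_)
    have hs' := support_of_chainForm_ne_zero hv hne'
    simp only [sliceSupport] at hs'
    exact Fin.ext (by omega)
  · ext i j
    by_contra hne
    have hs := support_of_chainForm_ne_zero hv hne
    simp only [sliceSupport] at hs
    refine hne (apply_eq_zero_of_eq_mul_jordan_sub h22 i j (i.val - j.val) (by omega) (by omega)
      fun i' j' h' hne' => ?_)
    have hs' := support_of_chainForm_ne_zero hv hne'
    simp only [sliceSupport] at hs'
    exact Fin.ext (by omega)


/-- The pairing of two basis vectors of the same chain contributes a sign given by the parity of
the position in the chain. -/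
theorem chainSign_mul_chainSign_swap (a : Idx m n ⊕ Idx m n) :
    (Sum.elim (fun _ => 1) (fun _ => -1) a : ℂ) * (chainSign a * chainSign a.swap) =
      Sum.elim (fun i => (-1) ^ (m - n + 1 + i.val)) (fun i => (-1) ^ (n + 1 + i.val))
        (chainEquiv m n a) := by
  have h1 : ∀ k i : ℕ, i < k → (-1 : ℂ) ^ (k - 1 - i) = (-1) ^ (k + 1 + i) := by
    intro k i h
    rw [show k + 1 + i = k - 1 - i + 2 * (i + 1) by omega, pow_add, pow_mul]
    simp
  have h2 : ∀ k i : ℕ, i < k → -(-1 : ℂ) ^ (k - 1 - i) = (-1) ^ (k + 1 + (2 * k - 1 - i)) := by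
    intro k i h
    rw [show k + 1 + (2 * k - 1 - i) = k - 1 - i + (2 * k + 1) by omega, pow_add, pow_succ,
      pow_mul]
    simp
  rcases a with ((a | a) | (a | a))
  · simp [chainSign, h1 _ _ a.2]
  · simp [chainSign, h1 _ _ a.2]
  · simp [chainSign, ← h2 _ _ a.2]
  · simp [chainSign, ← h2 _ _ a.2]

theorem chainForm_apply_swap {Y : Mat m n} (hY : Y ∈ spC (Idx m n)) (a b : Idx m n ⊕ Idx m n) :
    chainForm Y (chainEquiv m n a) (chainEquiv m n b) =
      -(Sum.elim (fun i => (-1) ^ (m - n + 1 + i.val)) (fun i => (-1) ^ (n + 1 + i.val))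
          (chainEquiv m n a) *
        Sum.elim (fun i => (-1) ^ (m - n + 1 + i.val)) (fun i => (-1) ^ (n + 1 + i.val))
          (chainEquiv m n b) *
        chainForm Y (chainEquiv m n b.swap) (chainEquiv m n a.swap)) := by
  rw [← chainSign_mul_chainSign_swap, ← chainSign_mul_chainSign_swap, chainForm_apply,
    chainForm_apply, spC_apply_swap hY]
  have ha := chainSign_mul_self a.swap
  have hb := chainSign_mul_self b.swap
  generalize (Sum.elim (fun _ => 1) (fun _ => -1) a : ℂ) = s
  generalize (Sum.elim (fun _ => 1) (fun _ => -1) b : ℂ) = t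
  linear_combination (s * t * chainSign a * chainSign b * Y b.swap a.swap) *
    (chainSign b.swap * chainSign b.swap * ha + hb)

/-- The entries of an element of `sp` on an even diagonal of the first diagonal block are
skew-symmetric under reversal. -/
theorem chainForm_inl_inl {Y : Mat m n} (hY : Y ∈ spC (Idx m n)) (i j : Fin (2 * (m - n)))
    (h : Even (i.val + j.val)) :
    chainForm Y (Sum.inl i) (Sum.inl j) = -chainForm Y (Sum.inl j.rev) (Sum.inl i.rev) := by
  obtain ⟨a, ha⟩ := (chainEquiv m n).surjective (Sum.inl i)
  obtain ⟨b, hb⟩ := (chainEquiv m n).surjective (Sum.inl j)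
  have := chainForm_apply_swap hY a b
  rw [chainEquiv_swap_inl ha, chainEquiv_swap_inl hb, ha, hb, Sum.elim_inl, Sum.elim_inl,
    ← pow_add, Even.neg_one_pow, one_mul] at this
  · exact this
  · rw [show m - n + 1 + i.val + (m - n + 1 + j.val) = 2 * (m - n + 1) + (i.val + j.val) by ring]
    exact (even_two_mul _).add h

theorem chainForm_inr_inr {Y : Mat m n} (hY : Y ∈ spC (Idx m n)) (i j : Fin (2 * n))
    (h : Even (i.val + j.val)) :
    chainForm Y (Sum.inr i) (Sum.inr j) = -chainForm Y (Sum.inr j.rev) (Sum.inr i.rev) := by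
  obtain ⟨a, ha⟩ := (chainEquiv m n).surjective (Sum.inr i)
  obtain ⟨b, hb⟩ := (chainEquiv m n).surjective (Sum.inr j)
  have := chainForm_apply_swap hY a b
  rw [chainEquiv_swap_inr ha, chainEquiv_swap_inr hb, ha, hb, Sum.elim_inr, Sum.elim_inr,
    ← pow_add, Even.neg_one_pow, one_mul] at this
  · exact this
  · rw [show n + 1 + i.val + (n + 1 + j.val) = 2 * (n + 1) + (i.val + j.val) by ring]
    exact (even_two_mul _).add h

/-- An element of `sp` orthogonal to the direction of the slice has zero entries at the transposed
positions. -/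
theorem apply_eq_zero_of_trace_orthogonal {Y : Mat m n} (hY : Y ∈ spC (Idx m n))
    (h : ∀ v ∈ sliceDirection m n, (Y * v).trace = 0)
    {k l : Fin (2 * (m - n)) ⊕ Fin (2 * n)} (hs : sliceSupport m n k l) :
    chainForm Y l k = 0 := by
  obtain ⟨a, rfl⟩ := (chainEquiv m n).surjective k
  obtain ⟨b, rfl⟩ := (chainEquiv m n).surjective l
  rw [chainForm_apply_eq_zero_iff]
  have hmem : spProj (Matrix.single a b 1) ∈ sliceDirection m n := by
    -- the second summand of `spProj` is supported at the position paired with `(a, b)`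
    refine ⟨spProj_mem _, fun c d hcd => ?_⟩
    have h1 : ¬ (a = c ∧ b = d) := by
      rintro ⟨rfl, rfl⟩
      exact hcd hs
    have h2 : ¬ (b.swap = c ∧ a.swap = d) := by
      rintro ⟨rfl, rfl⟩
      exact hcd (sliceSupport_swap hs)
    have hJ : ∀ x y : Idx m n ⊕ Idx m n, y ≠ x.swap → Matrix.J (Idx m n) ℂ x y = 0 := by
      rintro (x | x) (y | y) hxy
      · simp [Matrix.J]
      · have : x ≠ y := by
          rintro rfl
          exact hxy rfl
        simp [Matrix.J, this]
      · have : x ≠ y := by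
          rintro rfl
          exact hxy rfl
        simp [Matrix.J, this]
      · simp [Matrix.J]
    rw [spProj, Matrix.add_apply, Matrix.single_apply_of_ne _ _ _ _ _ h1, zero_add,
      Matrix.mul_apply]
    refine Finset.sum_eq_zero fun x _ => ?_
    rw [Matrix.mul_apply]
    by_cases hx : x = a
    · subst hx
      by_cases hd : d = x.swap
      · subst hd
        have hc : b ≠ c.swap := by
          rintro rfl
          exact h2 ⟨by simp, rfl⟩
        rw [Finset.sum_eq_zero, zero_mul]
        intro y _
        by_cases hy : y = b
        · subst hy
          rw [hJ _ _ hc, zero_mul]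
        · rw [transpose_apply, Matrix.single_apply_of_ne _ _ _ _ _ (fun h => hy h.2.symm), mul_zero]
      · rw [hJ _ _ hd, mul_zero]
    · rw [Finset.sum_eq_zero, zero_mul]
      intro y _
      rw [transpose_apply, Matrix.single_apply_of_ne _ _ _ _ _ (fun h => hx h.1.symm), mul_zero]
  have := h _ hmem
  rw [trace_mul_spProj hY, trace_mul_comm, Matrix.trace_single_mul] at this
  simpa using this

/-- An element of `sp` that commutes with `X_n` and is orthogonal to the direction of the slice
vanishes. -/
theorem eq_zero_of_commute_of_trace_orthogonal (hn : 2 * n ≤ m) {Y : Mat m n}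
    (hY : Y ∈ spC (Idx m n)) (hc : nilX m n * Y = Y * nilX m n)
    (h : ∀ v ∈ sliceDirection m n, (Y * v).trace = 0) : Y = 0 := by
  obtain ⟨⟨h11, -⟩, h21, h22⟩ := toBlocks_eq_of_eq_lie (v := 0) (A := Y) (by rw [hc, sub_self])
  have hz : chainForm (0 : Mat m n) = 0 := by simp [chainForm]
  rw [hz] at h11 h21 h22
  replace h11 := (sub_eq_zero.1 h11.symm).symm
  replace h21 := (sub_eq_zero.1 h21.symm).symm
  replace h22 := (sub_eq_zero.1 h22.symm).symm
  have z21 : (chainForm Y).toBlocks₂₁ = 0 := by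
    refine intertwiner_eq_zero h21 fun k hk hk' => ?_
    have key : ∃ (i : Fin (2 * n)) (j : Fin (2 * (m - n))), j.val = i.val + k ∧
        sliceSupport m n (Sum.inl j) (Sum.inr i) := by
      by_cases h1 : 2 * (m - n) ≤ k + n
      · by_cases h2 : k = 0
        · exact ⟨⟨n, by omega⟩, ⟨m - n, by omega⟩, by simp; omega, by simp [sliceSupport]; omega⟩
        · exact ⟨⟨2 * (m - n) - 1 - k, by omega⟩, ⟨2 * (m - n) - 1, by omega⟩, by simp; omega,
            by simp [sliceSupport]; omega⟩
      · by_cases h2 : k = 0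
        · exact ⟨⟨n, by omega⟩, ⟨m - n, by omega⟩, by simp; omega, by simp [sliceSupport]; omega⟩
        · exact ⟨⟨n - 1, by omega⟩, ⟨n - 1 + k, by omega⟩, by simp,
            by simp [sliceSupport]; omega⟩
    obtain ⟨i, j, hij, hs⟩ := key
    exact ⟨i, j, hij, apply_eq_zero_of_trace_orthogonal hY h hs⟩
  refine eq_zero_of_chainForm ?_ (toBlocks₁₂_chainForm_eq_zero hY z21) z21 ?_
  -- on even diagonals the symplectic condition forces an entry to equal its own negative
  · refine intertwiner_eq_zero h11 fun k hk _ => ?_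
    rcases Nat.even_or_odd' k with ⟨r, hr | hr⟩
    · refine ⟨⟨0, by omega⟩, ⟨k, hk⟩, by simp, ?_⟩
      have h1 := chainForm_inl_inl hY ⟨0, by omega⟩ ⟨k, hk⟩ (by simp [hr])
      have h2 := intertwiner_apply_eq h11 ⟨0, by omega⟩ (Fin.rev ⟨k, hk⟩) ⟨k, hk⟩
        (Fin.rev ⟨0, by omega⟩) (by simp [Fin.val_rev]; omega)
      simp only [toBlocks₁₁, of_apply] at h2 ⊢
      rw [← h2] at h1
      exact self_eq_neg.1 h1
    · exact ⟨⟨m - n - 1 - r, by omega⟩, ⟨m - n + r, by omega⟩, by simp; omega,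
        apply_eq_zero_of_trace_orthogonal hY h (by simp only [sliceSupport]; omega)⟩
  · refine intertwiner_eq_zero h22 fun k hk _ => ?_
    rcases Nat.even_or_odd' k with ⟨r, hr | hr⟩
    · refine ⟨⟨0, by omega⟩, ⟨k, hk⟩, by simp, ?_⟩
      have h1 := chainForm_inr_inr hY ⟨0, by omega⟩ ⟨k, hk⟩ (by simp [hr])
      have h2 := intertwiner_apply_eq h22 ⟨0, by omega⟩ (Fin.rev ⟨k, hk⟩) ⟨k, hk⟩
        (Fin.rev ⟨0, by omega⟩) (by simp [Fin.val_rev]; omega)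
      simp only [toBlocks₂₂, of_apply] at h2 ⊢
      rw [← h2] at h1
      exact self_eq_neg.1 h1
    · exact ⟨⟨n - 1 - r, by omega⟩, ⟨n + r, by omega⟩, by simp; omega,
        apply_eq_zero_of_trace_orthogonal hY h (by simp only [sliceSupport]; omega)⟩

theorem isAffineTransverseSlice (hn : 2 * n ≤ m) :
    IsAffineTransverseSlice (slice m n) (nilX m n) := by
  have hX : nilX m n ∈ spC (Idx m n) := nilX_mem_spC
  refine ⟨AffineSubspace.mk' (nilX m n) (sliceDirection m n), ?_, ?_, ?_, ?_, ?_⟩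
  · ext Y
    rw [mem_slice_iff hn, SetLike.mem_coe, AffineSubspace.mem_mk', vsub_eq_sub]
  · intro Y hY
    have := add_mem ((mem_slice_iff hn Y).1 hY).1 hX
    rwa [sub_add_cancel] at this
  · rw [mem_slice_iff hn, sub_self]
    exact zero_mem _
  · rw [AffineSubspace.direction_mk', orbitTangent_eq, eq_bot_iff]
    rintro v ⟨hv, A, -, rfl⟩
    exact disjoint_sliceDirection hn hv rfl
  · rw [AffineSubspace.direction_mk', orbitTangent_eq]
    have hle : sliceDirection m n ⊔ (spC (Idx m n)).map (adRight (nilX m n)) ≤ spC (Idx m n) := by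
      refine sup_le (fun v hv => hv.1) ?_
      rintro _ ⟨A, hA, rfl⟩
      exact lie_mem_spC hA hX
    refine le_antisymm hle (spC_le_of_trace_orthogonal _ hle fun Y hY h => ?_)
    refine eq_zero_of_commute_of_trace_orthogonal hn hY
      (commute_of_trace_orthogonal hX hY fun A hA => ?_)
      fun v hv => h v (Submodule.mem_sup_left hv)
    exact h _ (Submodule.mem_sup_right ⟨A, hA, rfl⟩)

/-! ### The Jacobson–Morozov triple -/

/-- The lower triangular block of the nilnegative element: `i (2k - i)` in position `(i + 1, i)`. -/
def lowerJordan (k : ℕ) : Matrix (Fin k) (Fin k) ℂ :=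
  Matrix.of fun i j => if i.val = j.val + 1 then (j.val + 1) * (2 * k - (j.val + 1)) else 0

theorem jordan_transpose_mul_corner (k : ℕ) : (jordan k)ᵀ * corner k = 0 := by
  ext i j
  rw [Matrix.mul_apply]
  refine Finset.sum_eq_zero fun x _ => ?_
  by_cases hx : x.val + 1 = i.val
  · have : ¬ x.val + 1 = k := by omega
    simp [corner, this]
  · simp [jordan, hx]

theorem corner_mul_jordan (k : ℕ) : corner k * jordan k = 0 := by
  rw [← transpose_eq_zero, transpose_mul, corner_transpose, jordan_transpose_mul_corner]

theorem lowerJordan_mul_corner (k : ℕ) : lowerJordan k * corner k = 0 := by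
  ext i j
  rw [Matrix.mul_apply]
  refine Finset.sum_eq_zero fun x _ => ?_
  by_cases hx : i.val = x.val + 1
  · have : ¬ x.val + 1 = k := by omega
    simp [corner, this]
  · simp [lowerJordan, hx]

theorem corner_mul_lowerJordan_transpose (k : ℕ) : corner k * (lowerJordan k)ᵀ = 0 := by
  rw [← transpose_eq_zero, transpose_mul, corner_transpose, transpose_transpose,
    lowerJordan_mul_corner]

theorem corner_mul_corner (k : ℕ) : corner k * corner k = corner k := by
  ext i j
  rw [Matrix.mul_apply]
  by_cases h : i.val + 1 = k ∧ j.val + 1 = k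
  · rw [Finset.sum_eq_single i]
    · simp [corner, h]
    · intro b _ hb
      have : ¬ b.val + 1 = k := fun h' => hb (Fin.ext (by omega))
      simp [corner, this]
    · simp
  · have h0 : corner k i j = 0 := by simp only [corner, of_apply, if_neg h]
    rw [h0]
    refine Finset.sum_eq_zero fun x _ => ?_
    by_cases hi : i.val + 1 = k
    · have hj : ¬ j.val + 1 = k := fun h' => h ⟨hi, h'⟩
      simp [corner, hj]
    · simp [corner, hi]

theorem jordan_lowerJordan_commutator (k : ℕ) :
    jordan k * lowerJordan k + (k : ℂ) ^ 2 • corner k - lowerJordan k * jordan k =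
      diagonal (weights k) := by
  ext i j
  rw [Matrix.sub_apply, Matrix.add_apply, jordan_mul_apply, mul_jordan_apply]
  simp only [lowerJordan, corner, of_apply, Matrix.smul_apply, smul_eq_mul]
  by_cases hij : i = j
  · subst hij
    rw [diagonal_apply_eq, weights]
    by_cases h1 : i.val + 1 < k
    · by_cases h2 : 0 < i.val
      · rw [dif_pos h1, if_pos h2, if_pos rfl, if_neg (by omega), if_pos (by omega),
          Nat.cast_sub h2]
        push_cast
        ring
      · have h3 : i.val = 0 := by omega
        rw [dif_pos h1, if_neg h2, if_pos rfl, if_neg (by omega), h3]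
        push_cast
        ring
    · have hk : (k : ℂ) = i.val + 1 := by
        exact_mod_cast (show k = i.val + 1 by omega)
      by_cases h2 : 0 < i.val
      · rw [dif_neg h1, if_pos h2, if_pos (by omega), if_pos (by omega), Nat.cast_sub h2, hk]
        push_cast
        ring
      · have h3 : i.val = 0 := by omega
        rw [dif_neg h1, if_neg h2, if_pos (by omega), hk, h3]
        push_cast
        ring
  · have hij' : i.val ≠ j.val := fun h => hij (Fin.ext h)
    rw [diagonal_apply_ne _ hij, if_neg (show ¬ (i.val + 1 = k ∧ j.val + 1 = k) by omega)]
    split_ifs <;> first | omega | simp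

/-- The nilnegative element of the Jacobson–Morozov triple of `(H_n, X_n)`. -/
def nilN (m n : ℕ) : Mat m n :=
  fromBlocks (fromBlocks (lowerJordan (m - n)) 0 0 (lowerJordan n)) 0
    (fromBlocks (((m - n : ℕ) : ℂ) ^ 2 • corner (m - n)) 0 0 ((n : ℂ) ^ 2 • corner n))
    (fromBlocks (-(lowerJordan (m - n))ᵀ) 0 0 (-(lowerJordan n)ᵀ))

/-- The diagonal entries of `H_n`. The entry of a matrix in position `(a, b)` has weight
`hWeight a - hWeight b` under `ad H_n`. -/
def hWeight (m n : ℕ) : Idx m n ⊕ Idx m n → ℂ :=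
  Sum.elim (Sum.elim (weights (m - n)) (weights n))
    (Sum.elim (fun i => -weights (m - n) i) (fun i => -weights n i))

theorem neutralH_eq : neutralH m n = diagonal (hWeight m n) := rfl

theorem hWeight_sub_of_nilX_ne_zero (a b : Idx m n ⊕ Idx m n) (h : nilX m n a b ≠ 0) :
    hWeight m n a - hWeight m n b = 2 := by
  have hJ : ∀ k (i j : Fin k), jordan k i j ≠ 0 → weights k i - weights k j = 2 := by
    intro k i j h
    have : i.val + 1 = j.val := by
      by_contra h'
      simp [jordan, h'] at h
    rw [weights, weights, ← this]
    push_cast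
    ring
  have hE : ∀ k (i j : Fin k), corner k i j ≠ 0 → weights k i + weights k j = 2 := by
    intro k i j h
    have : i.val + 1 = k ∧ j.val + 1 = k := by
      by_contra h'
      simp [corner, h'] at h
    have h1 : (k : ℂ) = i.val + 1 := by rw [← Nat.cast_add_one, this.1]
    have h2 : (k : ℂ) = j.val + 1 := by rw [← Nat.cast_add_one, this.2]
    rw [weights, weights]
    linear_combination 2 * h1 + 2 * h2
  rcases a with ((a | a) | (a | a)) <;> rcases b with ((b | b) | (b | b)) <;>
    simp only [nilX, fromBlocks_apply₁₁, fromBlocks_apply₁₂, fromBlocks_apply₂₁,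
      fromBlocks_apply₂₂, Matrix.zero_apply, ne_eq, not_true_eq_false, Matrix.neg_apply,
      transpose_apply, neg_eq_zero] at h <;>
    simp only [hWeight, Sum.elim_inl, Sum.elim_inr, sub_neg_eq_add]
  · exact hJ _ _ _ h
  · exact hE _ _ _ h
  · exact hJ _ _ _ h
  · exact hE _ _ _ h
  · rw [← hJ _ _ _ h]; ring
  · rw [← hJ _ _ _ h]; ring

theorem hWeight_sub_of_nilN_ne_zero (a b : Idx m n ⊕ Idx m n) (h : nilN m n a b ≠ 0) :
    hWeight m n a - hWeight m n b = -2 := by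
  have hJ : ∀ k (i j : Fin k), lowerJordan k i j ≠ 0 → weights k i - weights k j = -2 := by
    intro k i j h
    have : i.val = j.val + 1 := by
      by_contra h'
      simp [lowerJordan, h'] at h
    rw [weights, weights, this]
    push_cast
    ring
  have hE : ∀ (c : ℂ) k (i j : Fin k), (c • corner k) i j ≠ 0 →
      -weights k i - weights k j = -2 := by
    intro c k i j h
    have : i.val + 1 = k ∧ j.val + 1 = k := by
      by_contra h'
      simp [corner, h'] at h
    have h1 : (k : ℂ) = i.val + 1 := by rw [← Nat.cast_add_one, this.1]
    have h2 : (k : ℂ) = j.val + 1 := by rw [← Nat.cast_add_one, this.2]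
    rw [weights, weights]
    linear_combination -2 * h1 - 2 * h2
  rcases a with ((a | a) | (a | a)) <;> rcases b with ((b | b) | (b | b)) <;>
    simp only [nilN, fromBlocks_apply₁₁, fromBlocks_apply₁₂, fromBlocks_apply₂₁,
      fromBlocks_apply₂₂, Matrix.zero_apply, ne_eq, not_true_eq_false, Matrix.neg_apply,
      transpose_apply, neg_eq_zero] at h <;>
    simp only [hWeight, Sum.elim_inl, Sum.elim_inr]
  · exact hJ _ _ _ h
  · exact hJ _ _ _ h
  · exact hE _ _ _ _ h
  · rw [← hJ _ _ _ h]; ring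
  · exact hE _ _ _ _ h
  · rw [← hJ _ _ _ h]; ring

theorem neutralH_lie {M : Mat m n} {c : ℂ}
    (h : ∀ a b, M a b ≠ 0 → hWeight m n a - hWeight m n b = c) :
    neutralH m n * M - M * neutralH m n = c • M := by
  ext a b
  rw [neutralH_eq, Matrix.sub_apply, diagonal_mul, mul_diagonal, Matrix.smul_apply, smul_eq_mul]
  by_cases h0 : M a b = 0
  · simp [h0]
  · rw [← h a b h0]
    ring

theorem neutralH_eq_fromBlocks : neutralH m n =
    fromBlocks (fromBlocks (diagonal (weights (m - n))) 0 0 (diagonal (weights n))) 0 0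
      (fromBlocks (-diagonal (weights (m - n))) 0 0 (-diagonal (weights n))) := by
  rw [diagonal_neg, diagonal_neg, fromBlocks_diagonal, fromBlocks_diagonal, fromBlocks_diagonal]
  rfl

theorem nilX_lie_nilN : nilX m n * nilN m n - nilN m n * nilX m n = neutralH m n := by
  have hJ : ∀ k, jordan k * lowerJordan k + (k : ℂ) ^ 2 • corner k + -(lowerJordan k * jordan k) =
      diagonal (weights k) := fun k => by
    rw [← sub_eq_add_neg, jordan_lowerJordan_commutator]
  have hJt : ∀ k, (jordan k)ᵀ * (lowerJordan k)ᵀ + (-((k : ℂ) ^ 2 • corner k) +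
      -((lowerJordan k)ᵀ * (jordan k)ᵀ)) = -diagonal (weights k) := fun k => by
    rw [← transpose_mul, ← transpose_mul, ← diagonal_transpose, ← jordan_lowerJordan_commutator,
      transpose_sub, transpose_add, transpose_smul, corner_transpose]
    abel
  rw [neutralH_eq_fromBlocks, nilX, nilN]
  simp only [fromBlocks_multiply, Matrix.mul_zero, Matrix.zero_mul, add_zero, zero_add,
    fromBlocks_add, sub_eq_add_neg, fromBlocks_neg, Matrix.mul_neg, Matrix.neg_mul, neg_neg,
    Matrix.mul_smul, Matrix.smul_mul, corner_mul_corner, corner_mul_lowerJordan_transpose,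
    lowerJordan_mul_corner, jordan_transpose_mul_corner, corner_mul_jordan, neg_zero, smul_zero,
    hJ, hJt, neg_add, fromBlocks_zero]

theorem isJMTriple (m n : ℕ) : IsJMTriple (neutralH m n) (nilX m n) (nilN m n) where
  memH := by
    rw [neutralH_eq_fromBlocks, fromBlocks_mem_spC_iff, fromBlocks_transpose, fromBlocks_neg]
    simp
  memX := nilX_mem_spC
  memN := by
    rw [nilN, fromBlocks_mem_spC_iff, fromBlocks_transpose, fromBlocks_neg, fromBlocks_transpose]
    simp [corner_transpose]
  lie_H_X := neutralH_lie hWeight_sub_of_nilX_ne_zero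
  lie_H_N := neutralH_lie hWeight_sub_of_nilN_ne_zero
  lie_X_N := nilX_lie_nilN

/-! ### The `ℂˣ`-action -/

theorem exp_smul_neutralH (s : ℂ) :
    NormedSpace.exp (s • neutralH m n) = diagonal fun a => Complex.exp (s * hWeight m n a) := by
  rw [neutralH_eq, ← diagonal_smul, Matrix.exp_diagonal]
  congr 1
  ext a
  rw [Pi.coe_exp, Complex.exp_eq_exp_ℂ]
  simp

theorem lambdaAction_apply (r : ℂ) (Y : Mat m n) (a b : Idx m n ⊕ Idx m n) :
    lambdaAction (neutralH m n) r Y a b =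
      r * Complex.exp (-(Complex.log r / 2) * (hWeight m n a - hWeight m n b)) * Y a b := by
  rw [lambdaAction, exp_smul_neutralH, exp_smul_neutralH, Matrix.smul_apply, mul_diagonal,
    diagonal_mul, smul_eq_mul, mul_sub, sub_eq_add_neg, Complex.exp_add, neg_mul, neg_mul, neg_neg]
  ring

theorem lambdaAction_nilX {r : ℂ} (hr : r ≠ 0) :
    lambdaAction (neutralH m n) r (nilX m n) = nilX m n := by
  ext a b
  rw [lambdaAction_apply]
  by_cases h0 : nilX m n a b = 0
  · rw [h0, mul_zero]
  · rw [hWeight_sub_of_nilX_ne_zero a b h0, show -(Complex.log r / 2) * 2 = -Complex.log r by ring,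
      Complex.exp_neg, Complex.exp_log hr, mul_inv_cancel₀ hr, one_mul]

theorem hWeight_swap (a : Idx m n ⊕ Idx m n) : hWeight m n a.swap = -hWeight m n a := by
  rcases a with ((a | a) | (a | a)) <;> simp [hWeight]

theorem mem_spC_of_apply_swap {Y : Mat m n}
    (h : ∀ a b, Y a b = -((Sum.elim (fun _ => 1) (fun _ => -1) a : ℂ) *
      Sum.elim (fun _ => 1) (fun _ => -1) b * Y b.swap a.swap)) : Y ∈ spC (Idx m n) := by
  rw [← fromBlocks_toBlocks Y, fromBlocks_mem_spC_iff]
  refine ⟨?_, ?_, ?_⟩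
  · ext i j
    have := h (Sum.inr i) (Sum.inr j)
    simpa [toBlocks₁₁, toBlocks₂₂] using this
  · ext i j
    have := h (Sum.inl j) (Sum.inr i)
    simpa [toBlocks₁₂] using this
  · ext i j
    have := h (Sum.inr j) (Sum.inl i)
    simpa [toBlocks₂₁] using this

theorem sliceDirection_of_entrywise_mul {c : Idx m n ⊕ Idx m n → Idx m n ⊕ Idx m n → ℂ}
    (hc : ∀ a b, c b.swap a.swap = c a b) {v w : Mat m n} (hv : v ∈ sliceDirection m n)
    (hw : ∀ a b, w a b = c a b * v a b) : w ∈ sliceDirection m n := by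
  refine ⟨mem_spC_of_apply_swap fun a b => ?_, fun a b h => by rw [hw, hv.2 a b h, mul_zero]⟩
  rw [hw, hw, hc, spC_apply_swap hv.1]
  ring

/-- The action scales the entries of a matrix by nonzero factors, and the entries that the
symplectic form identifies by the same factor; so it preserves the direction of the slice. -/
theorem isLambdaInvariant (hn : 2 * n ≤ m) : IsLambdaInvariant (neutralH m n) (slice m n) := by
  intro r hr
  -- the factor by which `λ_r` multiplies the entry in position `(a, b)`
  set c : Idx m n ⊕ Idx m n → Idx m n ⊕ Idx m n → ℂ := fun a b =>
    r * Complex.exp (-(Complex.log r / 2) * (hWeight m n a - hWeight m n b)) with hc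
  have hc0 : ∀ a b, c a b ≠ 0 := fun a b => mul_ne_zero hr (Complex.exp_ne_zero _)
  have hcs : ∀ a b, c b.swap a.swap = c a b := fun a b => by
    rw [hc]
    simp only [hWeight_swap]
    rw [show -hWeight m n b - -hWeight m n a = hWeight m n a - hWeight m n b by ring]
  have hX : ∀ a b, c a b * nilX m n a b = nilX m n a b := fun a b => by
    conv_rhs => rw [← lambdaAction_nilX (m := m) (n := n) hr]
    rw [lambdaAction_apply]
  ext Y
  constructor
  · rintro ⟨Y, hY, rfl⟩
    rw [mem_slice_iff hn] at hY ⊢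
    refine sliceDirection_of_entrywise_mul hcs hY fun a b => ?_
    rw [Matrix.sub_apply, Matrix.sub_apply, lambdaAction_apply, mul_sub (c a b), hX]
  · intro hY
    rw [mem_slice_iff hn] at hY
    refine ⟨Matrix.of fun a b => (c a b)⁻¹ * Y a b, ?_, ?_⟩
    · rw [mem_slice_iff hn]
      refine sliceDirection_of_entrywise_mul (c := fun a b => (c a b)⁻¹)
        (fun a b => by rw [hcs]) hY fun a b => ?_
      rw [Matrix.sub_apply, Matrix.sub_apply, of_apply, mul_sub]
      congr 1
      rw [eq_inv_mul_iff_mul_eq₀ (hc0 a b), hX]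
    · ext a b
      rw [lambdaAction_apply, of_apply]
      exact mul_inv_cancel_left₀ (hc0 a b) _

/-! ### The characteristic polynomial -/

/-- The last basis vector of `ℂ^k`, as a column. -/
def lastCol (k : ℕ) : Matrix (Fin k) (Fin 1) ℂ :=
  Matrix.of fun i _ => if i.val + 1 = k then 1 else 0

/-- The column `(s - J_k)⁻¹ e_k = (s^{-k}, …, s^{-1})`. -/
def resolventCol (k : ℕ) (s : ℂ) : Matrix (Fin k) (Fin 1) ℂ :=
  Matrix.of fun i _ => s⁻¹ ^ (k - i.val)

theorem corner_eq_lastCol_mul (k : ℕ) : corner k = lastCol k * (lastCol k)ᵀ := by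
  ext i j
  simp only [Matrix.mul_apply, lastCol, corner, of_apply, transpose_apply, Fin.sum_univ_one]
  by_cases h1 : i.val + 1 = k <;> by_cases h2 : j.val + 1 = k <;> simp [h1, h2]

theorem sub_jordan_mul_resolventCol (k : ℕ) {s : ℂ} (hs : s ≠ 0) :
    (s • (1 : Matrix (Fin k) (Fin k) ℂ) - jordan k) * resolventCol k s = lastCol k := by
  ext i j
  rw [Matrix.sub_mul, Matrix.smul_mul, Matrix.one_mul, Matrix.sub_apply, jordan_mul_apply,
    Matrix.smul_apply, smul_eq_mul]
  simp only [resolventCol, lastCol, of_apply]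
  obtain ⟨r, hr⟩ : ∃ r, k - i.val = r + 1 := ⟨k - i.val - 1, by omega⟩
  rw [hr, pow_succ', mul_inv_cancel_left₀ hs]
  by_cases h : i.val + 1 < k
  · rw [dif_pos h, if_neg (by omega), show k - (i.val + 1) = r by omega, sub_self]
  · rw [dif_neg h, if_pos (by omega), show r = 0 by omega]
    simp

theorem det_sub_jordan (k : ℕ) (s : ℂ) :
    (s • (1 : Matrix (Fin k) (Fin k) ℂ) - jordan k).det = s ^ k := by
  rw [det_of_isUpperTriangular]
  · simp [jordan]
  · intro i j hij
    have h1 : i ≠ j := ne_of_gt hij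
    have h2 : ¬ i.val + 1 = j.val := by
      have : j.val < i.val := hij
      omega
    simp [jordan, h1, h2]

/-- The upper left block of `s - S`. -/
def shiftedBlock (m n : ℕ) (ζ s : ℂ) : Matrix (Idx m n) (Idx m n) ℂ :=
  s • 1 - (fromBlocks (jordan (m - n)) 0 0 (jordan n) + cornerShift ζ)

theorem shiftedBlock_eq (ζ s : ℂ) : shiftedBlock m n ζ s =
    fromBlocks (s • 1 - jordan (m - n)) 0
      (-Matrix.of fun i j => if i.val + 1 = n ∧ j.val + 1 = m - n then ζ else 0)
      (s • 1 - jordan n) := by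
  rw [shiftedBlock, cornerShift, ← fromBlocks_one, fromBlocks_smul, fromBlocks_add,
    sub_eq_add_neg, fromBlocks_neg, fromBlocks_add]
  simp [sub_eq_add_neg]

theorem det_shiftedBlock (ζ s : ℂ) :
    (shiftedBlock m n ζ s).det = s ^ (m - n) * s ^ n := by
  rw [shiftedBlock_eq, det_fromBlocks_zero₁₂, det_sub_jordan, det_sub_jordan]

/-- The columns `(s - J_{m-n})⁻¹ e_{m-n}` and `(s - J_n)⁻¹ e_n`, corrected by the contribution of
the entry `ζ`. -/
def resolventCols (m n : ℕ) (ζ s : ℂ) : Matrix (Idx m n) (Fin 1 ⊕ Fin 1) ℂ :=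
  fromBlocks (resolventCol (m - n) s) 0 ((ζ * s⁻¹) • resolventCol n s) (resolventCol n s)

theorem shiftedBlock_mul_resolventCols (hn : 2 * n ≤ m) (ζ : ℂ) {s : ℂ} (hs : s ≠ 0) :
    shiftedBlock m n ζ s * resolventCols m n ζ s =
      fromBlocks (lastCol (m - n)) 0 0 (lastCol n) := by
  have h : -(Matrix.of fun (i : Fin n) (j : Fin (m - n)) =>
      if i.val + 1 = n ∧ j.val + 1 = m - n then ζ else 0) * resolventCol (m - n) s +
      (ζ * s⁻¹) • lastCol n = 0 := by
    ext i j
    rw [Matrix.neg_mul, Matrix.add_apply, Matrix.neg_apply, Matrix.mul_apply,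
      Finset.sum_eq_single (⟨m - n - 1, by have := i.2; omega⟩ : Fin (m - n))]
    · have e1 : m - n - (m - n - 1) = 1 := by have := i.2; omega
      have e2 : m - n - 1 + 1 = m - n := by have := i.2; omega
      simp only [of_apply, resolventCol, lastCol, Matrix.smul_apply, smul_eq_mul,
        Matrix.zero_apply]
      rw [e1, pow_one]
      by_cases hi : i.val + 1 = n
      · rw [if_pos ⟨hi, e2⟩, if_pos hi]
        ring
      · rw [if_neg (fun h' => hi h'.1), if_neg hi]
        ring
    · intro b _ hb
      have : ¬ (i.val + 1 = n ∧ b.val + 1 = m - n) := fun h' => hb (Fin.ext (by simp; omega))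
      simp [this]
    · simp
  rw [shiftedBlock_eq, resolventCols, fromBlocks_multiply, Matrix.mul_smul (s • 1 - jordan n),
    sub_jordan_mul_resolventCol _ hs, sub_jordan_mul_resolventCol _ hs, h]
  simp

theorem det_fromBlocks_fin_one (A B C D : Matrix (Fin 1) (Fin 1) ℂ) :
    (fromBlocks A B C D).det = A 0 0 * D 0 0 - B 0 0 * C 0 0 := by
  rw [← det_submatrix_equiv_self finSumFinEquiv.symm, det_fin_two]
  rfl

/-- If the upper right block of a matrix is `-ε εᵀ` with `ε = A R` and `ε = -Dᵀ R'`, its determinant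
is reduced to one of the size of the number of columns of `ε`. -/
theorem det_fromBlocks_of_low_rank {ι κ : Type} [Fintype ι] [DecidableEq ι] [Fintype κ]
    [DecidableEq κ] {A D M : Matrix ι ι ℂ} {ε R R' : Matrix ι κ ℂ} (hA : IsUnit A.det)
    (hR : A * R = ε) (hR' : Dᵀ * R' = -ε) :
    (fromBlocks A (-(ε * εᵀ)) (-M) D).det = A.det * D.det * (1 + R'ᵀ * M * R).det := by
  have := Matrix.invertibleOfIsUnitDet A hA
  have h1 : ⅟A * ε = R := by rw [← hR, ← Matrix.mul_assoc, invOf_mul_self, Matrix.one_mul]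
  have h2 : εᵀ = -(R'ᵀ * D) := by
    rw [← neg_eq_iff_eq_neg, ← transpose_neg, ← hR', transpose_mul, transpose_transpose]
  have h3 : D - -M * ⅟A * -(ε * εᵀ) = (1 + M * R * R'ᵀ) * D := by
    rw [Matrix.mul_neg, Matrix.neg_mul, Matrix.neg_mul, neg_neg, Matrix.mul_assoc M,
      ← Matrix.mul_assoc (⅟A), h1, h2, Matrix.add_mul, Matrix.one_mul, Matrix.mul_neg,
      Matrix.mul_neg, sub_neg_eq_add]
    simp only [Matrix.mul_assoc]
  rw [det_fromBlocks₁₁, h3, det_mul, det_one_add_mul_comm, ← Matrix.mul_assoc]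
  ring

/-- The value of the bilinear pairing of the columns `(-s - J)⁻¹ e` and `(s - J)⁻¹ e` given by the
upper right block of `M(a, y, z, d)`. -/
def crossPairing (m : ℕ) {n : ℕ} (y z : Fin n → ℂ) (s : ℂ) : ℂ :=
  ((resolventCol (m - n) (-s))ᵀ * crossBlock (m := m) y z * resolventCol n s :
    Matrix (Fin 1) (Fin 1) ℂ) 0 0

theorem resolventCol_pairing_crossBlock_transpose (y z : Fin n → ℂ) (s : ℂ) :
    ((resolventCol n (-s))ᵀ * (crossBlock (m := m) y z)ᵀ * resolventCol (m - n) s :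
      Matrix (Fin 1) (Fin 1) ℂ) 0 0 = crossPairing m y z (-s) := by
  rw [crossPairing, neg_neg]
  have h : (resolventCol n (-s))ᵀ * (crossBlock (m := m) y z)ᵀ * resolventCol (m - n) s =
      ((resolventCol (m - n) s)ᵀ * crossBlock (m := m) y z * resolventCol n (-s))ᵀ := by
    simp only [transpose_mul, transpose_transpose, Matrix.mul_assoc]
  rw [h, transpose_apply]

theorem resolventCol_pairing_diagonal (k : ℕ) (c : Fin k → ℂ) {s : ℂ} (hs : s ≠ 0) :
    s ^ (2 * k) * (1 + ((resolventCol k (-s))ᵀ * (diagonal fun i : Fin k => c i.rev) *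
      resolventCol k s : Matrix (Fin 1) (Fin 1) ℂ) 0 0) = (evenPoly c).eval s := by
  rw [evenPoly, eval_add, eval_pow, eval_X, eval_finsetSum, mul_add, mul_one, Matrix.mul_apply,
    Finset.mul_sum, ← Equiv.sum_comp Fin.revPerm]
  congr 1
  refine Finset.sum_congr rfl fun j _ => ?_
  simp only [eval_mul, eval_C, eval_pow, eval_X, mul_diagonal, transpose_apply, resolventCol,
    of_apply, Fin.revPerm_apply, Fin.rev_rev, Fin.val_rev]
  have hj : k - (k - (j.val + 1)) = j.val + 1 := by omega
  have h1 : s ^ (2 * k) = s ^ (2 * (k - (j.val + 1))) * (s ^ (j.val + 1) * s ^ (j.val + 1)) := by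
    rw [← pow_add, ← pow_add]
    congr 1
    omega
  rw [hj, h1, inv_neg, neg_pow, inv_pow]
  have h2 : s ^ (j.val + 1) ≠ 0 := pow_ne_zero _ hs
  field_simp

theorem resolventCol_pairing_corner {k : ℕ} (hk : 0 < k) (s : ℂ) :
    ((resolventCol k (-s))ᵀ * corner k * resolventCol k s :
      Matrix (Fin 1) (Fin 1) ℂ) 0 0 = -(s⁻¹ * s⁻¹) := by
  have h : ∀ s, ((lastCol k)ᵀ * resolventCol k s : Matrix (Fin 1) (Fin 1) ℂ) 0 0 = s⁻¹ := fun s => by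
    rw [Matrix.mul_apply, Finset.sum_eq_single (⟨k - 1, by omega⟩ : Fin k)]
    · simp only [transpose_apply, lastCol, resolventCol, of_apply]
      rw [if_pos (by omega), show k - (k - 1) = 1 by omega, pow_one, one_mul]
    · intro b _ hb
      have : ¬ b.val + 1 = k := fun h' => hb (Fin.ext (by simp; omega))
      simp [lastCol, this]
    · simp
  have h' : (resolventCol k (-s))ᵀ * lastCol k = ((lastCol k)ᵀ * resolventCol k (-s))ᵀ := by
    rw [transpose_mul, transpose_transpose]
  rw [corner_eq_lastCol_mul, ← Matrix.mul_assoc, Matrix.mul_assoc, h', Matrix.mul_apply,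
    Fin.sum_univ_one, transpose_apply, h, h, inv_neg, neg_mul]

theorem crossPairing_eq_sum (hn : 2 * n ≤ m) (y z : Fin n → ℂ) (s : ℂ) :
    crossPairing m y z s = ∑ j : Fin n, ((-s)⁻¹ ^ (m - n) * y j * s⁻¹ ^ (n - j.val) +
      if j.val + 1 < m - n then (-s)⁻¹ ^ (m - n - (j.val + 1)) * z j * s⁻¹ else 0) := by
  have h0 : crossPairing m y z s = ∑ i : Fin (m - n), ∑ k : Fin n,
      (-s)⁻¹ ^ (m - n - i.val) * crossBlock y z i k * s⁻¹ ^ (n - k.val) := by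
    rw [crossPairing, Matrix.mul_apply]
    simp only [Matrix.mul_apply, Finset.sum_mul, transpose_apply, resolventCol, of_apply]
    rw [Finset.sum_comm]
  rw [h0, Finset.sum_add_distrib]
  simp only [crossBlock, of_apply, mul_add, add_mul, Finset.sum_add_distrib]
  congr 1
  · rw [Finset.sum_comm]
    refine Finset.sum_congr rfl fun k _ => ?_
    rw [Finset.sum_eq_single (⟨0, by have := k.2; omega⟩ : Fin (m - n))]
    · simp
    · intro b _ hb
      have : ¬ b.val = 0 := fun h' => hb (Fin.ext h')
      simp [this]
    · simp
  · simp only [Finset.mul_sum, Finset.sum_mul]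
    have h1 : ∀ i : Fin (m - n), ∑ k : Fin n, ∑ j : Fin n, (-s)⁻¹ ^ (m - n - i.val) *
        (if i.val = j.val + 1 ∧ k.val + 1 = n then z j else 0) * s⁻¹ ^ (n - k.val) =
        ∑ j : Fin n, if i.val = j.val + 1 then (-s)⁻¹ ^ (m - n - i.val) * z j * s⁻¹ else 0 := by
      intro i
      rw [Finset.sum_comm]
      refine Finset.sum_congr rfl fun j _ => ?_
      rw [Finset.sum_eq_single (⟨n - 1, by have := j.2; omega⟩ : Fin n)]
      · have e1 : n - 1 + 1 = n := by have := j.2; omega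
        have e2 : n - (n - 1) = 1 := by have := j.2; omega
        by_cases h : i.val = j.val + 1
        · simp [h, e1, e2]
        · simp [h]
      · intro b _ hb
        have : ¬ b.val + 1 = n := fun h' => hb (Fin.ext (by simp; omega))
        simp [this]
      · simp
    simp only [h1]
    rw [Finset.sum_comm]
    refine Finset.sum_congr rfl fun j _ => ?_
    by_cases h : j.val + 1 < m - n
    · rw [if_pos h, Finset.sum_eq_single (⟨j.val + 1, h⟩ : Fin (m - n))]
      · simp
      · intro b _ hb
        have : ¬ b.val = j.val + 1 := fun h' => hb (Fin.ext h')
        simp [this]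
      · simp
    · rw [if_neg h]
      refine Finset.sum_eq_zero fun i _ => ?_
      rw [if_neg (by omega)]

/-- The coefficient `ζ` contributes the term of `z_n` for which there is no room in the cross block
if `m = 2n`. -/
theorem crossPairing_add (hn : 2 * n ≤ m) (y z : Fin n → ℂ) {s : ℂ} (hs : s ≠ 0) :
    s ^ (m - n) * s ^ n * (crossPairing m y z s + shiftCoeff m z * s⁻¹) =
      (-1) ^ (m - n) * (polyB y z).eval s := by
  have hz : shiftCoeff m z * s⁻¹ =
      ∑ j : Fin n, if j.val + 1 < m - n then 0 else z j * s⁻¹ := by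
    rw [shiftCoeff]
    split_ifs with h
    · rw [zLast, Finset.sum_mul]
      refine Finset.sum_congr rfl fun j _ => ?_
      by_cases hj : j.val + 1 = n
      · rw [if_pos hj, if_neg (by omega)]
      · rw [if_neg hj, if_pos (by omega), zero_mul]
    · rw [zero_mul, eq_comm]
      refine Finset.sum_eq_zero fun j _ => ?_
      rw [if_pos (by omega)]
  rw [hz, crossPairing_eq_sum hn, ← Finset.sum_add_distrib, polyB, eval_sub, eval_mul, eval_pow,
    eval_X, eval_finsetSum, eval_finsetSum, Finset.mul_sum, Finset.mul_sum,
    ← Finset.sum_sub_distrib, Finset.mul_sum]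
  refine Finset.sum_congr rfl fun j _ => ?_
  have h1 : ((if j.val + 1 < m - n then (-s)⁻¹ ^ (m - n - (j.val + 1)) * z j * s⁻¹ else 0) +
      if j.val + 1 < m - n then 0 else z j * s⁻¹) =
      (-s)⁻¹ ^ (m - n - (j.val + 1)) * z j * s⁻¹ := by
    split_ifs with h
    · rw [add_zero]
    · rw [show m - n - (j.val + 1) = 0 by omega]
      simp
  rw [add_assoc, h1]
  simp only [eval_mul, eval_C, eval_pow, eval_X]
  obtain ⟨u, hu⟩ : ∃ u, m - n = u + (j.val + 1) := ⟨m - n - (j.val + 1), by omega⟩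
  obtain ⟨w, hw⟩ : ∃ w, n - j.val = w := ⟨_, rfl⟩
  have hw' : s ^ n = s ^ w * s ^ j.val := by
    rw [← pow_add]
    congr 1
    omega
  have hsign : ((-1 : ℂ) ^ j.val) * (-1) ^ j.val = 1 := by
    rw [← mul_pow]
    simp
  rw [hw, show m - n - (j.val + 1) = u by omega, hu, hw', inv_neg, neg_pow (s⁻¹), neg_pow (s⁻¹),
    inv_pow, inv_pow, inv_pow, pow_add (-1 : ℂ), pow_add s, pow_succ (-1 : ℂ), pow_succ s]
  have n1 : s ^ u ≠ 0 := pow_ne_zero _ hs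
  have n2 : s ^ w ≠ 0 := pow_ne_zero _ hs
  have n3 : s ^ j.val ≠ 0 := pow_ne_zero _ hs
  field_simp
  linear_combination (-(s ^ w * s ^ j.val * z j)) * hsign

/-- The determinant of the `2 × 2` matrix to which the characteristic polynomial reduces. The
contributions of `ζ²` cancel because `d_1` is replaced by `d_1 - ζ²`. -/
theorem det_one_add_resolventCols (a y z : Fin n → ℂ) (d : Fin (m - n) → ℂ)
    (s : ℂ) :
    (1 + (resolventCols m n (shiftCoeff m z) (-s))ᵀ *
      (lowerM a y z d - fromBlocks ((shiftCoeff m z) ^ 2 • corner (m - n)) 0 0 0) *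
      resolventCols m n (shiftCoeff m z) s).det =
    (1 + ((resolventCol (m - n) (-s))ᵀ * (diagonal fun i : Fin (m - n) => d i.rev) *
      resolventCol (m - n) s : Matrix (Fin 1) (Fin 1) ℂ) 0 0) *
    (1 + ((resolventCol n (-s))ᵀ * (diagonal fun i : Fin n => a i.rev) *
      resolventCol n s : Matrix (Fin 1) (Fin 1) ℂ) 0 0) -
    (crossPairing m y z s + shiftCoeff m z * s⁻¹) *
      (crossPairing m y z (-s) + shiftCoeff m z * (-s)⁻¹) := by
  have hcorner : (shiftCoeff m z) ^ 2 * ((resolventCol (m - n) (-s))ᵀ * corner (m - n) *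
      resolventCol (m - n) s : Matrix (Fin 1) (Fin 1) ℂ) 0 0 =
      -((shiftCoeff m z) ^ 2 * (s⁻¹ * s⁻¹)) := by
    by_cases h : 0 < m - n
    · rw [resolventCol_pairing_corner h]
      ring
    · have h0 : shiftCoeff m z = 0 := by
        rw [shiftCoeff]
        split_ifs
        · rw [zLast]
          refine Finset.sum_eq_zero fun j _ => ?_
          have := j.2
          omega
        · rfl
      rw [h0]
      ring
  rw [← resolventCol_pairing_crossBlock_transpose, crossPairing, lowerM, sub_eq_add_neg,
    fromBlocks_neg, fromBlocks_add, resolventCols, resolventCols, fromBlocks_transpose,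
    fromBlocks_multiply, fromBlocks_multiply, ← fromBlocks_one, fromBlocks_add,
    det_fromBlocks_fin_one]
  simp only [Matrix.add_apply, Matrix.mul_add, Matrix.add_mul, Matrix.mul_neg, Matrix.neg_mul,
    Matrix.neg_apply, Matrix.smul_mul, Matrix.mul_smul, transpose_smul, Matrix.smul_apply,
    smul_eq_mul, Matrix.one_apply_eq, Matrix.zero_apply, neg_zero, add_zero, zero_add,
    Matrix.mul_zero, Matrix.zero_mul, transpose_zero, inv_neg, mul_neg, neg_mul, smul_zero]
  linear_combination (-(1 + ((resolventCol n (-s))ᵀ * (diagonal fun i : Fin n => a i.rev) *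
      resolventCol n s : Matrix (Fin 1) (Fin 1) ℂ) 0 0)) * hcorner

theorem scalar_sub_sliceS (a y z : Fin n → ℂ) (d : Fin (m - n) → ℂ) (t : ℂ) :
    scalar (Idx m n ⊕ Idx m n) t - sliceS a y z d =
      fromBlocks (shiftedBlock m n (shiftCoeff m z) t)
        (-(fromBlocks (lastCol (m - n)) 0 0 (lastCol n) *
          (fromBlocks (lastCol (m - n)) 0 0 (lastCol n) : Matrix (Idx m n) (Fin 1 ⊕ Fin 1) ℂ)ᵀ))
        (-(lowerM a y z d - fromBlocks ((shiftCoeff m z) ^ 2 • corner (m - n)) 0 0 0))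
        (-(shiftedBlock m n (shiftCoeff m z) (-t))ᵀ) := by
  have h1 : (scalar (Idx m n ⊕ Idx m n) t : Mat m n) = fromBlocks (t • 1) 0 0 (t • 1) := by
    rw [scalar_apply, ← smul_one_eq_diagonal, ← fromBlocks_one, fromBlocks_smul]
    simp
  have h2 : (fromBlocks (lastCol (m - n)) 0 0 (lastCol n) *
      (fromBlocks (lastCol (m - n)) 0 0 (lastCol n) : Matrix (Idx m n) (Fin 1 ⊕ Fin 1) ℂ)ᵀ) =
      fromBlocks (corner (m - n)) 0 0 (corner n) := by
    rw [fromBlocks_transpose, fromBlocks_multiply, corner_eq_lastCol_mul, corner_eq_lastCol_mul]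
    simp
  have h3 : (fromBlocks (-(jordan (m - n))ᵀ) 0 0 (-(jordan n)ᵀ) : Matrix (Idx m n) (Idx m n) ℂ) =
      -(fromBlocks (jordan (m - n)) 0 0 (jordan n))ᵀ := by
    rw [fromBlocks_transpose, fromBlocks_neg]
    simp
  rw [h1, h2, sliceS_eq, nilX, h3, fromBlocks_add, sub_eq_add_neg, fromBlocks_neg, fromBlocks_add,
    shiftedBlock, shiftedBlock, transpose_sub, transpose_smul, transpose_one, transpose_add]
  congr 1 <;> simp [sub_eq_add_neg]
  abel

theorem charpoly_sliceS (hn : 2 * n ≤ m) (a y z : Fin n → ℂ) (d : Fin (m - n) → ℂ) :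
    (sliceS a y z d).charpoly = evenPoly a * evenPoly d +
      (-1) ^ (m + 1) * polyB y z * (polyB y z).comp (-Polynomial.X) := by
  refine eq_of_infinite_eval_eq _ _
    (Set.Infinite.mono ?_ (Set.finite_singleton (0 : ℂ)).infinite_compl)
  -- it suffices to compare values at `t ≠ 0`, where the resolvent exists
  intro t ht
  have ht : t ≠ 0 := ht
  have hnt : -t ≠ 0 := neg_ne_zero.2 ht
  have hA : IsUnit (shiftedBlock m n (shiftCoeff m z) t).det := by
    rw [det_shiftedBlock]
    exact (mul_ne_zero (pow_ne_zero _ ht) (pow_ne_zero _ ht)).isUnit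
  have hR' : (-(shiftedBlock m n (shiftCoeff m z) (-t))ᵀ)ᵀ *
      resolventCols m n (shiftCoeff m z) (-t) = -fromBlocks (lastCol (m - n)) 0 0 (lastCol n) := by
    rw [transpose_neg, transpose_transpose, Matrix.neg_mul,
      shiftedBlock_mul_resolventCols hn _ hnt]
  have hD : (-(shiftedBlock m n (shiftCoeff m z) (-t))ᵀ).det = t ^ (m - n) * t ^ n := by
    rw [det_neg, det_transpose, det_shiftedBlock, Fintype.card_sum, Fintype.card_fin,
      Fintype.card_fin, pow_add, mul_mul_mul_comm, ← mul_pow, ← mul_pow]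
    simp
  -- the product of the off-diagonal entries of the `2 × 2` matrix
  have hB := crossPairing_add hn y z ht
  have hB' := crossPairing_add hn y z hnt
  have hBB : t ^ (m - n) * t ^ n * (t ^ (m - n) * t ^ n) *
      ((crossPairing m y z t + shiftCoeff m z * t⁻¹) *
        (crossPairing m y z (-t) + shiftCoeff m z * (-t)⁻¹)) =
      (-1) ^ m * ((polyB y z).eval t * (polyB y z).eval (-t)) := by
    have hs : ((-1 : ℂ) ^ (m - n) * (-1) ^ n) = (-1) ^ m := by
      rw [← pow_add, Nat.sub_add_cancel (by omega)]
    have hs1 : ((-1 : ℂ) ^ (m - n) * (-1) ^ (m - n)) = 1 := by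
      rw [← mul_pow]
      simp
    have hs2 : ((-1 : ℂ) ^ n * (-1) ^ n) = 1 := by
      rw [← mul_pow]
      simp
    rw [neg_pow t, neg_pow t n] at hB'
    set x := t ^ (m - n) * t ^ n with hx
    set w := crossPairing m y z (-t) + shiftCoeff m z * (-t)⁻¹
    have hw : x * w = (-1) ^ n * (polyB y z).eval (-t) := by
      linear_combination (-1) ^ (m - n) * (-1) ^ n * hB' - x * w * ((-1) ^ n * (-1) ^ n) * hs1 -
        x * w * hs2 + (-1) ^ n * (polyB y z).eval (-t) * hs1
    rw [← hs]
    linear_combination (x * w) * hB + (-1) ^ (m - n) * (polyB y z).eval t * hw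
  change eval t _ = eval t _
  rw [eval_charpoly, scalar_sub_sliceS, det_fromBlocks_of_low_rank hA
    (shiftedBlock_mul_resolventCols hn _ ht) hR', hD, det_shiftedBlock,
    det_one_add_resolventCols, mul_sub, hBB, eval_add, eval_mul, eval_mul, eval_mul, eval_comp,
    ← resolventCol_pairing_diagonal n a ht, ← resolventCol_pairing_diagonal (m - n) d ht]
  simp only [eval_pow, eval_neg, eval_one, eval_X]
  ring

end SympSlice

end

theorem mainTheorem4 (m n : ℕ) (hn : 2 * n ≤ m) :
    SympSlice.HasPartition (SympSlice.nilX m n) (2 * (m - n)) (2 * n) ∧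
    SympSlice.IsAffineTransverseSlice (SympSlice.slice m n) (SympSlice.nilX m n) ∧
    (∃ N, SympSlice.IsJMTriple (SympSlice.neutralH m n) (SympSlice.nilX m n) N) ∧
    SympSlice.IsLambdaInvariant (SympSlice.neutralH m n) (SympSlice.slice m n) ∧
    ∀ (a y z : Fin n → ℂ) (d : Fin (m - n) → ℂ),
      (SympSlice.sliceS a y z d).charpoly =
        SympSlice.evenPoly a * SympSlice.evenPoly d +
          (-1) ^ (m + 1) * SympSlice.polyB y z * (SympSlice.polyB y z).comp (-Polynomial.X) :=
  ⟨SympSlice.hasPartition_nilX m n, SympSlice.isAffineTransverseSlice hn,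
    ⟨SympSlice.nilN m n, SympSlice.isJMTriple m n⟩, SympSlice.isLambdaInvariant hn,
    SympSlice.charpoly_sliceS hn⟩
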